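/- Let $n\ge 2$, $0<T<\infty$, $\mathbb{R}^n_T=\mathbb{R}^n\times(0,T)$, and let $S^{n\times n}$ be the real symmetric $n\times n$ matrices. Let $H:\mathbb{R}^n\times S^{n\times n}\to\mathbb{R}$ be continuous and satisfy, for some constant $k_1\ge 0$: (A) $H(q,X)\le H(q,Y)$ whenever $X\le Y$, and $H(q,O)=0$ for all $q$; (B) $H(\theta q,X)=|\theta|^{k_1}H(q,X)$ for all $\theta\in\mathbb{R}$ (with $|\theta|^0=1$), and $H(q,\theta X)=\theta H(q,X)$ for all $\theta>0$; (C) $\max_{|e|=1}H(e,-I)<0<\min_{|e|=1}H(e,I)$. Assume moreover $\Lambda^{\sup}:=\sup_{\lambda\in\mathbb{R}}\max_{|e|=1}H(e,\lambda\, e\otimes e+I)<\infty$. Put $k=k_1+1$ and, if $k>1$, $\gamma^*=\frac{k+1}{k-1}$. Let $g:\mathbb{R}^n\to(0,\infty)$ be continuous with $0<\inf g\le\sup g<\infty$. Fix $z\in\mathbb{R}^n$ and let $B^R_T=\{(x,t):|x-z|\le R,\ 0<t<T\}$. Differential inequalities are understood in the viscosity sense, and $u$ is real-valued. For $k>1$,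 let $f:[0,\infty)\to[0,\infty)$ be $C^1$, nondecreasing, positive on $(0,\infty)$ (for instance strictly increasing), with $f^{1/(k-1)}$ concave. When a function $\phi$ is used below, it is a strictly increasing function $\phi:I\to[0,\infty)$ with $\phi'=f(\phi)^{1/(k-1)}$ on $I$ (one-sided derivative at an end point), where $I=[0,\infty)$ or $I=\mathbb{R}$. (a) Maximum principle. Let $k>1$, and let $\phi$ be as above with $I=[0,\infty)$ or $I=\mathbb{R}$. Let $u$ be upper semicontinuous and positive on $\mathbb{R}^n\times[0,T]$, with $H(Du,D^2u)-f(u)u_t\ge 0$ in $\mathbb{R}^n_T$ and $u(\cdot,0)\le g$. If there is a function $\eta(R)=o(R^{\gamma^*})$ such that, for all large $R$, $\eta(R)\in I$ and $\sup_{B^R_T}u\le\phi(\eta(R))$, then $\sup_{\mathbb{R}^n_T}u\le\sup_{\mathbb{R}^n}g$. Let $k=1$ and $f\equiv 1$. Let $u$ be upper semicontinuous on $\mathbb{R}^n\times[0,T]$ (not necessarily positive), with $H(Du,D^2u)-u_t\ge0$ in $\mathbb{R}^n_T$ and $u(\cdot,0)\le g$. If $\sup_{B^R_T}u\le e^{\eta(R)}$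 for all large $R$, for some $\eta(R)=o(R^2)$, then $\sup_{\mathbb{R}^n_T}u\le\sup_{\mathbb{R}^n} g$. (b) Minimum principle. Let $k>1$, and let $u$ be lower semicontinuous and positive on $\mathbb{R}^n\times[0,T]$, with $H(Du,D^2u)-f(u)u_t\le 0$ in $\mathbb{R}^n_T$ and $u(\cdot,0)\ge g$. (i) If $\lim_{\varepsilon\to0^+}\int_\varepsilon^1 f^{-1/(k-1)}\,ds<\infty$, then $u\ge\inf_{\mathbb{R}^n}g$ in $\mathbb{R}^n_T$. (ii) If $\lim_{\varepsilon\to0^+}\int_\varepsilon^1 f^{-1/(k-1)}\,ds=\infty$, $\phi$ is as above with $I=\mathbb{R}$, and $\inf_{B^R_T}u\ge\phi(-\eta(R))$ for all large $R$, for some $\eta(R)=o(R^{\gamma^*})$, then $u\ge\inf_{\mathbb{R}^n}g$ in $\mathbb{R}^n_T$. Let $k=1$ and $f\equiv1$. Let $u$ be lower semicontinuous on $\mathbb{R}^n\times[0,T]$ (not necessarily positive), with $H(Du,D^2u)-u_t\le0$ in $\mathbb{R}^n_T$ and $u(\cdot,0)\ge g$. If $\inf_{B^R_T}u\ge-e^{\eta(R)}$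 for all large $R$, for some $\eta(R)=o(R^2)$, then $u\ge\inf_{\mathbb{R}^n} g$ in $\mathbb{R}^n_T$. -/

import Mathlib

open Set Filter Topology Asymptotics

/-- `ℝⁿ` with the Euclidean norm. -/
abbrev Rn (n : ℕ) : Type := EuclideanSpace ℝ (Fin n)

/-- The matrix `e ⊗ e`, with entries `eᵢ eⱼ`. -/
def outer {n : ℕ} (e : Rn n) : Matrix (Fin n) (Fin n) ℝ :=
  Matrix.of fun i j => e i * e j

/-- The structural conditions on the operator `H : ℝⁿ × S^{n×n} → ℝ`.  Only the values of `H` at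
symmetric matrices matter; accordingly every condition is imposed at symmetric matrices only. -/
structure IsStructuralOperator {n : ℕ} (H : Rn n → Matrix (Fin n) (Fin n) ℝ → ℝ) (k₁ : ℝ) :
    Prop where
  /-- Continuity on `ℝⁿ × S^{n×n}`. -/
  continuousOn : ContinuousOn (fun p : Rn n × Matrix (Fin n) (Fin n) ℝ => H p.1 p.2)
    {p | p.2.IsSymm}
  /-- Monotonicity: `X ≤ Y` (that is, `Y - X` positive semidefinite) gives `H(q,X) ≤ H(q,Y)`. -/
  mono : ∀ (q : Rn n) (X Y : Matrix (Fin n) (Fin n) ℝ), X.IsSymm → Y.IsSymm →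
    (Y - X).PosSemidef → H q X ≤ H q Y
  zero : ∀ q : Rn n, H q 0 = 0
  k₁_nonneg : 0 ≤ k₁
  /-- Homogeneity in the gradient (for `k₁ = 0`, `|θ| ^ k₁ = 1` for all real `θ`). -/
  homog_left : ∀ (θ : ℝ) (q : Rn n) (X : Matrix (Fin n) (Fin n) ℝ), X.IsSymm →
    H (θ • q) X = |θ| ^ k₁ * H q X
  /-- Homogeneity in the Hessian. -/
  homog_right : ∀ (θ : ℝ) (q : Rn n) (X : Matrix (Fin n) (Fin n) ℝ), 0 < θ → X.IsSymm →
    H q (θ • X) = θ * H q X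
  /-- `max_{|e|=1} H(e,-I) < 0`; the maximum over the compact unit sphere is attained. -/
  neg_id : ∀ e : Rn n, ‖e‖ = 1 → H e (-1) < 0
  /-- `0 < min_{|e|=1} H(e,I)`; the minimum over the compact unit sphere is attained. -/
  pos_id : ∀ e : Rn n, ‖e‖ = 1 → 0 < H e 1

/-- `Λ_max(l) = max_{|e|=1} H(e, l e⊗e + I)`, as an extended real. -/
noncomputable def LambdaMax {n : ℕ} (H : Rn n → Matrix (Fin n) (Fin n) ℝ → ℝ) (l : ℝ) : EReal :=
  ⨆ e ∈ Metric.sphere (0 : Rn n) 1, ((H e (l • outer e + 1) : ℝ) : EReal)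

/-- `Λ^sup = sup_l Λ_max(l)`, as an extended real. -/
noncomputable def LambdaSup {n : ℕ} (H : Rn n → Matrix (Fin n) (Fin n) ℝ → ℝ) : EReal :=
  ⨆ l : ℝ, LambdaMax H l

/-- The spatial Hessian matrix `D²ψ(x,t)`. -/
noncomputable def spatialHessian {n : ℕ} (ψ : Rn n → ℝ → ℝ) (x : Rn n) (t : ℝ) :
    Matrix (Fin n) (Fin n) ℝ :=
  Matrix.of fun i j =>
    fderiv ℝ (fderiv ℝ (fun y => ψ y t)) x (EuclideanSpace.single i 1) (EuclideanSpace.single j 1)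

/-- `ψ` is `C²` in `x` and `C¹` in `t` on the open set `U`: the derivatives `Dψ`, `D²ψ`, `ψ_t`
exist at every point of `U` and are jointly continuous on `U`. -/
structure IsC21On {n : ℕ} (ψ : Rn n → ℝ → ℝ) (U : Set (Rn n × ℝ)) : Prop where
  isOpen : IsOpen U
  diff_x : ∀ p ∈ U, DifferentiableAt ℝ (fun y => ψ y p.2) p.1
  diff_xx : ∀ p ∈ U, DifferentiableAt ℝ (fderiv ℝ (fun y => ψ y p.2)) p.1
  diff_t : ∀ p ∈ U, DifferentiableAt ℝ (ψ p.1) p.2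
  cont_x : ContinuousOn (fun p : Rn n × ℝ => fderiv ℝ (fun y => ψ y p.2) p.1) U
  cont_xx : ContinuousOn (fun p : Rn n × ℝ => fderiv ℝ (fderiv ℝ (fun y => ψ y p.2)) p.1) U
  cont_t : ContinuousOn (fun p : Rn n × ℝ => deriv (ψ p.1) p.2) U

/-- `H(Du, D²u) - f(u) u_t ≥ 0` in `ℝⁿ × (0,T)` in the viscosity sense: the inequality holds for
the derivatives of every test function `ψ` (`C²` in `x` and `C¹` in `t` near the point) at every
point of the open strip at which `u - ψ` has a local maximum. -/
def IsViscositySubsolution {n : ℕ} (H : Rn n → Matrix (Fin n) (Fin n) ℝ → ℝ) (f : ℝ → ℝ) (T : ℝ)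
    (u : Rn n → ℝ → ℝ) : Prop :=
  ∀ (x₀ : Rn n), ∀ t₀ ∈ Ioo 0 T, ∀ (ψ : Rn n → ℝ → ℝ) (U : Set (Rn n × ℝ)),
    IsC21On ψ U → (x₀, t₀) ∈ U →
    IsLocalMax (fun p : Rn n × ℝ => u p.1 p.2 - ψ p.1 p.2) (x₀, t₀) →
    0 ≤ H (gradient (fun y => ψ y t₀) x₀) (spatialHessian ψ x₀ t₀)
      - f (u x₀ t₀) * deriv (ψ x₀) t₀

/-- `H(Du, D²u) - f(u) u_t ≤ 0` in `ℝⁿ × (0,T)` in the viscosity sense: as for subsolutions, with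
the opposite inequality at local minima of `u - ψ`. -/
def IsViscositySupersolution {n : ℕ} (H : Rn n → Matrix (Fin n) (Fin n) ℝ → ℝ) (f : ℝ → ℝ) (T : ℝ)
    (u : Rn n → ℝ → ℝ) : Prop :=
  ∀ (x₀ : Rn n), ∀ t₀ ∈ Ioo 0 T, ∀ (ψ : Rn n → ℝ → ℝ) (U : Set (Rn n × ℝ)),
    IsC21On ψ U → (x₀, t₀) ∈ U →
    IsLocalMin (fun p : Rn n × ℝ => u p.1 p.2 - ψ p.1 p.2) (x₀, t₀) →
    H (gradient (fun y => ψ y t₀) x₀) (spatialHessian ψ x₀ t₀)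
      - f (u x₀ t₀) * deriv (ψ x₀) t₀ ≤ 0

/-- The closed strip `ℝⁿ × [0,T]`. -/
def closedStrip (n : ℕ) (T : ℝ) : Set (Rn n × ℝ) := univ ×ˢ Icc 0 T

/-- The cylinder `B^R_T = {(x,t) : |x - z| ≤ R, 0 < t < T}`. -/
def cylinder {n : ℕ} (z : Rn n) (R T : ℝ) : Set (Rn n × ℝ) := {p | ‖p.1 - z‖ ≤ R ∧ p.2 ∈ Ioo 0 T}

/-- The assumptions on `f : [0,∞) → [0,∞)` for a given `k > 1`: `C¹`, increasing (only in the weak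
sense, but positive away from `0`), with `f^{1/(k-1)}` concave. -/
structure IsAdmissibleNonlinearity (k : ℝ) (f : ℝ → ℝ) : Prop where
  contDiffOn : ContDiffOn ℝ 1 f (Ici 0)
  nonneg : ∀ s, 0 ≤ s → 0 ≤ f s
  monotoneOn : MonotoneOn f (Ici 0)
  pos : ∀ s, 0 < s → 0 < f s
  concaveOn : ConcaveOn ℝ (Ici 0) (fun s => f s ^ (1 / (k - 1)))

/-- `∫_ε^1 f^{-1/(k-1)}`, which is `F(1) - F(ε)` for any primitive `F` of `f^{-1/(k-1)}` on
`(0,∞)`. -/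
noncomputable def primitiveIncrement (k : ℝ) (f : ℝ → ℝ) (ε : ℝ) : ℝ :=
  ∫ s in ε..1, f s ^ (-(1 / (k - 1)))

/-- `φ : I → [0,∞)` is increasing and `φ' = f(φ)^{1/(k-1)}` on `I` (one-sided at an end point of
`I`).  For `f` admissible, such a `φ` is automatically `C²` in the interior of `I`. -/
structure IsChangeOfVariable (k : ℝ) (f φ : ℝ → ℝ) (I : Set ℝ) : Prop where
  nonneg : ∀ τ ∈ I, 0 ≤ φ τ
  strictMonoOn : StrictMonoOn φ I
  hasDeriv : ∀ τ ∈ I, HasDerivWithinAt φ (f (φ τ) ^ (1 / (k - 1))) I τ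

/-! For `k > 1` let `G = primitive k f`, so that `G' = f^{-1/(k-1)}`, and put `v = G(u)`. If `Φ`
inverts `G`, then `Φ'^{k-1} = f(Φ)`. In `u = Φ(v)` homogeneity pulls `Φ'^k = f(u) Φ'` out of `H`,
and formally `H(Dv, D²v + κ Dv⊗Dv) - v_t` keeps its sign, with `κ = Φ''/Φ' ≥ 0`. So `f` survives
only in a rank-one term.

It remains to compare `v` with the smooth barrier `w = ε(1+t)(1+|x-z|²)^p + ε/(T-t)`, `2p = γ*`,
added to the constant `G(M)`, where `M` bounds the initial data (`-v` and `-G(M)` for minima). As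
the barrier is smooth, `Φ(±w + m)` is itself a test function at a contact point, and no doubling of
variables is needed. Two facts exclude contact. The rank-one terms are harmless: `Λ^sup < ∞` absorbs
them for subsolutions (`radial_le`), and monotonicity together with `κ ≥ 0` controls them for
supersolutions (`le_radial`). The exponent is critical: the spatial terms are at most a constant
times `ε^k (1+|x-z|²)^p` (`radial_rate_le`), which `w_t ≥ ε(1+|x-z|²)^p` beats for small `ε`. Growth
`o(R^{γ*})` puts `v` below the barrier far away, `ε/(T-t)` does so near `t = T`, and `ε → 0` ends
the proof (`touching_absurd`, `barrier_limit`).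

For `k = 1` the barrier is `M + δ exp(w)`, with `w` quadratic in space and an exponential rate in
time; then `δ → 0`. -/

/-! ### Test functions and derivatives of radial functions. -/

/-- A jointly `C²` function is an admissible parabolic test function. -/
theorem isC21On_of_contDiffOn {n : ℕ} {ψ : Rn n → ℝ → ℝ} {U : Set (Rn n × ℝ)} (hU : IsOpen U)
    (h : ContDiffOn ℝ 2 (fun p : Rn n × ℝ => ψ p.1 p.2) U) : IsC21On ψ U := by
  set F : Rn n × ℝ → ℝ := fun p => ψ p.1 p.2 with hF
  have hd : ∀ p ∈ U, DifferentiableAt ℝ F p := fun p hp =>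
    (h.contDiffAt (hU.mem_nhds hp)).differentiableAt (by norm_num)
  have hF1 : ContDiffOn ℝ 1 (fderiv ℝ F) U := h.fderiv_of_isOpen hU (by norm_num)
  have hinl : ∀ (p : Rn n × ℝ), HasFDerivAt (fun y : Rn n => (y, p.2))
      (ContinuousLinearMap.inl ℝ (Rn n) ℝ) p.1 := fun p => hasFDerivAt_prodMk_left p.1 p.2
  have hinr : ∀ (p : Rn n × ℝ), HasFDerivAt (fun s : ℝ => (p.1, s))
      (ContinuousLinearMap.inr ℝ (Rn n) ℝ) p.2 := fun p => hasFDerivAt_prodMk_right p.1 p.2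
  let D : Rn n × ℝ → (Rn n →L[ℝ] ℝ) := fun p =>
    (fderiv ℝ F p).comp (ContinuousLinearMap.inl ℝ (Rn n) ℝ)
  have hD1 : ContDiffOn ℝ 1 D U := hF1.clm_comp contDiffOn_const
  have hx : ∀ p ∈ U, HasFDerivAt (fun y => ψ y p.2) (D p) p.1 := fun p hp =>
    HasFDerivAt.comp (g := F) p.1 (hd p hp).hasFDerivAt (hinl p)
  have hDd : ∀ p ∈ U, DifferentiableAt ℝ D p := fun p hp =>
    (hD1.contDiffAt (hU.mem_nhds hp)).differentiableAt (by norm_num)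
  have hxx : ∀ p ∈ U, HasFDerivAt (fderiv ℝ (fun y => ψ y p.2))
      ((fderiv ℝ D p).comp (ContinuousLinearMap.inl ℝ (Rn n) ℝ)) p.1 := by
    intro p hp
    have h1 : HasFDerivAt (fun y => D (y, p.2))
        ((fderiv ℝ D p).comp (ContinuousLinearMap.inl ℝ (Rn n) ℝ)) p.1 :=
      HasFDerivAt.comp (g := D) p.1 (hDd p hp).hasFDerivAt (hinl p)
    refine h1.congr_of_eventuallyEq ?_
    have hev : ∀ᶠ y in 𝓝 p.1, (y, p.2) ∈ U :=
      (hinl p).continuousAt.preimage_mem_nhds (hU.mem_nhds hp)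
    filter_upwards [hev] with y hy using (hx (y, p.2) hy).fderiv
  have ht : ∀ p ∈ U, HasDerivAt (ψ p.1) (fderiv ℝ F p (0, 1)) p.2 := by
    intro p hp
    have := (HasFDerivAt.comp (g := F) p.2 (hd p hp).hasFDerivAt (hinr p)).hasDerivAt
    rwa [ContinuousLinearMap.comp_apply, ContinuousLinearMap.inr_apply] at this
  refine ⟨hU, fun p hp => (hx p hp).differentiableAt, fun p hp => (hxx p hp).differentiableAt,
    fun p hp => (ht p hp).differentiableAt, ?_, ?_, ?_⟩
  · exact hD1.continuousOn.congr fun p hp => (hx p hp).fderiv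
  · have : ContinuousOn (fderiv ℝ D) U :=
      (hD1.fderiv_of_isOpen (m := 0) hU (by norm_num)).continuousOn
    exact (this.clm_comp continuousOn_const).congr fun p hp => (hxx p hp).fderiv
  · exact (hF1.continuousOn.clm_apply continuousOn_const).congr fun p hp => (ht p hp).deriv

/-- Working with the squared distance keeps radial functions smooth at the centre `z`, so `x = z`
needs no separate treatment. -/
theorem hasFDerivAt_comp_norm_sub_sq {n : ℕ} (z x : Rn n) {q : ℝ → ℝ} {q' : ℝ}
    (hq : HasDerivAt q q' (‖x - z‖ ^ 2)) :
    HasFDerivAt (fun y : Rn n => q (‖y - z‖ ^ 2)) ((2 * q') • innerSL ℝ (x - z)) x := by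
  have h1 : HasFDerivAt (fun y : Rn n => ‖y - z‖ ^ 2) ((2 : ℝ) • innerSL ℝ (x - z)) x := by
    have := ((hasFDerivAt_id x).sub_const z).norm_sq
    refine this.congr_fderiv ?_
    ext v
    simp
  refine (hq.comp_hasFDerivAt x h1).congr_fderiv ?_
  rw [smul_smul, mul_comm]

/-- Gradient and Hessian of a radial function. -/
theorem gradient_hessian_radial {n : ℕ} (z x : Rn n) {ψ : Rn n → ℝ → ℝ} {t : ℝ} {q q₁ : ℝ → ℝ}
    {q₂ : ℝ} (hψ : ∀ y, ψ y t = q (‖y - z‖ ^ 2))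
    (hq : ∀ᶠ s in 𝓝 (‖x - z‖ ^ 2), HasDerivAt q (q₁ s) s)
    (hq₁ : HasDerivAt q₁ q₂ (‖x - z‖ ^ 2)) :
    gradient (fun y => ψ y t) x = (2 * q₁ (‖x - z‖ ^ 2)) • (x - z) ∧
    spatialHessian ψ x t = (2 * q₁ (‖x - z‖ ^ 2)) • (1 : Matrix (Fin n) (Fin n) ℝ)
      + (4 * q₂) • outer (x - z) := by
  have hψ' : (fun y => ψ y t) = fun y => q (‖y - z‖ ^ 2) := funext hψ
  have hcont : ContinuousAt (fun y : Rn n => ‖y - z‖ ^ 2) x := by fun_prop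
  have hev : ∀ᶠ y in 𝓝 x, fderiv ℝ (fun y => ψ y t) y =
      (2 * q₁ (‖y - z‖ ^ 2)) • innerSL ℝ (y - z) := by
    filter_upwards [hcont.eventually hq] with y hy
    rw [hψ']
    exact (hasFDerivAt_comp_norm_sub_sq z y hy).fderiv
  constructor
  · rw [gradient, hev.self_of_nhds, map_smul]
    congr 1
    rw [LinearIsometryEquiv.symm_apply_eq]
    ext v
    simp
  · have h1 : HasFDerivAt (fun y : Rn n => 2 * q₁ (‖y - z‖ ^ 2))
        ((2 : ℝ) • ((2 * q₂) • innerSL ℝ (x - z))) x :=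
      (hasFDerivAt_comp_norm_sub_sq z x hq₁).const_mul 2
    have h2 : HasFDerivAt (fun y : Rn n => innerSL ℝ (y - z))
        (innerSL ℝ : Rn n →L[ℝ] Rn n →L[ℝ] ℝ) x := by
      simpa using ((innerSL ℝ : Rn n →L[ℝ] Rn n →L[ℝ] ℝ).hasFDerivAt (x := x)).sub_const
        (innerSL ℝ z)
    have h3 := (h1.smul h2).congr_of_eventuallyEq hev
    ext i j
    simp only [spatialHessian, Matrix.of_apply, h3.fderiv, Matrix.add_apply, Matrix.smul_apply,
      outer, smul_eq_mul]
    have h4 : innerSL ℝ (EuclideanSpace.single i (1 : ℝ)) (EuclideanSpace.single j (1 : ℝ)) =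
        if i = j then 1 else 0 := by
      simp [EuclideanSpace.inner_single_left]
    simp [h4, EuclideanSpace.inner_single_right, Matrix.one_apply]
    ring

/-! ### Rank-one matrices and bounds on `H` at radial derivatives. -/

theorem outer_isSymm {n : ℕ} (e : Rn n) : (outer e).IsSymm := by
  ext i j
  simp [outer, mul_comm]

theorem outer_smul {n : ℕ} (r : ℝ) (e : Rn n) : outer (r • e) = r ^ 2 • outer e := by
  ext i j
  simp [outer]
  ring

theorem outer_posSemidef {n : ℕ} (e : Rn n) : (outer e).PosSemidef := by
  have : outer e = Matrix.vecMulVec (fun i => e i) (star fun i => e i) := by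
    ext i j
    simp [outer, Matrix.vecMulVec]
  rw [this]
  exact Matrix.posSemidef_vecMulVec_self_star _

theorem one_sub_outer_posSemidef {n : ℕ} {e : Rn n} (he : ‖e‖ = 1) :
    (1 - outer e : Matrix (Fin n) (Fin n) ℝ).PosSemidef := by
  refine Matrix.PosSemidef.of_dotProduct_mulVec_nonneg ?_ fun v => ?_
  · rw [Matrix.IsHermitian, Matrix.conjTranspose_eq_transpose_of_trivial]
    exact (Matrix.isSymm_one.sub (outer_isSymm e))
  · have h1 : outer e = Matrix.vecMulVec (fun i => e i) (fun i => e i) := by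
      ext i j
      simp [outer, Matrix.vecMulVec]
    have h2 : inner ℝ e (WithLp.toLp 2 v) = v ⬝ᵥ fun i => e i := by
      simp [PiLp.inner_apply, dotProduct]
    have h3 : ‖WithLp.toLp 2 v‖ ^ 2 = v ⬝ᵥ v := by
      rw [EuclideanSpace.real_norm_sq_eq]
      simp [dotProduct, sq]
    have h4 : |inner ℝ e (WithLp.toLp 2 v)| ≤ ‖WithLp.toLp 2 v‖ := by
      simpa [he] using abs_real_inner_le_norm e (WithLp.toLp 2 v)
    rw [star_trivial, Matrix.sub_mulVec, Matrix.one_mulVec, dotProduct_sub, h1,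
      Matrix.vecMulVec_mulVec]
    simp only [dotProduct_smul, MulOpposite.smul_eq_mul_unop, MulOpposite.unop_op]
    rw [← h3, dotProduct_comm (fun i => e i) v, ← h2]
    have := (sq_abs _).symm.le.trans (pow_le_pow_left₀ (abs_nonneg _) h4 2)
    nlinarith

/-- Every vector is a nonnegative multiple of a unit vector. -/
theorem exists_polar {n : ℕ} (hn : 2 ≤ n) (y : Rn n) : ∃ e : Rn n, ‖e‖ = 1 ∧ y = ‖y‖ • e := by
  by_cases hy : y = 0
  · refine ⟨EuclideanSpace.single ⟨0, by omega⟩ 1, by simp, by simp [hy]⟩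
  · have : ‖y‖ ≠ 0 := norm_ne_zero_iff.mpr hy
    exact ⟨‖y‖⁻¹ • y, by simp [norm_smul, this], by rw [smul_smul, mul_inv_cancel₀ this, one_smul]⟩

namespace IsStructuralOperator

variable {n : ℕ} {H : Rn n → Matrix (Fin n) (Fin n) ℝ → ℝ} {k₁ : ℝ}

/-- Polar form of `H` at the derivatives of a radial function. -/
theorem radial_eq (hH : IsStructuralOperator H k₁) {e : Rn n} {a b r θ σ : ℝ}
    (ha : 0 < a) (hr : 0 ≤ r) (hθ : |θ| = a) :
    H (θ • (r • e)) ((σ * a) • 1 + b • outer (r • e)) =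
      (a * r) ^ k₁ * (a * H e ((b * r ^ 2 / a) • outer e + σ • 1)) := by
  have hs : ∀ l m : ℝ, (l • outer e + m • (1 : Matrix (Fin n) (Fin n) ℝ)).IsSymm := fun l m =>
    ((outer_isSymm e).smul l).add (Matrix.isSymm_one.smul m)
  have : (σ * a) • 1 + b • outer (r • e) =
      a • ((b * r ^ 2 / a) • outer e + σ • (1 : Matrix (Fin n) (Fin n) ℝ)) := by
    rw [outer_smul, smul_add, smul_smul, smul_smul, smul_smul, add_comm, mul_comm σ,
      mul_div_cancel₀ _ ha.ne']
  rw [smul_smul, this, hH.homog_left _ _ _ ((hs _ _).smul a), hH.homog_right _ _ _ ha (hs _ _),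
    abs_mul, hθ, abs_of_nonneg hr]

/-- In polar form the coefficient of `e ⊗ e` becomes the free parameter of `Λ^sup`; hence no
condition on `b` is required. -/
theorem radial_le (hH : IsStructuralOperator H k₁) (hn : 2 ≤ n) {Λ : ℝ}
    (hΛ : ∀ e : Rn n, ‖e‖ = 1 → ∀ l : ℝ, H e (l • outer e + 1) ≤ Λ) {a b : ℝ} (ha : 0 < a)
    (y : Rn n) :
    H (a • y) (a • 1 + b • outer y) ≤ Λ * ((a * ‖y‖) ^ k₁ * a) := by
  obtain ⟨e, he, hy⟩ := exists_polar hn y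
  have h := hH.radial_eq (e := e) (b := b) (σ := 1) ha (norm_nonneg y) (abs_of_pos ha)
  rw [← hy, one_mul, one_smul] at h
  rw [h]
  have h2 : 0 ≤ (a * ‖y‖) ^ k₁ * a := by positivity
  nlinarith [mul_le_mul_of_nonneg_left (hΛ e he (b * ‖y‖ ^ 2 / a)) h2]

/-- Since `0 ≤ e ⊗ e ≤ I`, a matrix `l e⊗e - I` with `l ≥ -μ` dominates `-(1+μ) I`, where `H` is
controlled by its values at `-I`. -/
theorem le_radial (hH : IsStructuralOperator H k₁) (hn : 2 ≤ n) {C : ℝ}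
    (hC : ∀ e : Rn n, ‖e‖ = 1 → -C ≤ H e (-1)) {a b μ : ℝ} (ha : 0 < a) (hμ : 0 ≤ μ)
    (y : Rn n) (hb : -(μ * a) ≤ b * ‖y‖ ^ 2) :
    -(C * (1 + μ) * ((a * ‖y‖) ^ k₁ * a)) ≤ H (-a • y) (-a • 1 + b • outer y) := by
  obtain ⟨e, he, hy⟩ := exists_polar hn y
  have h := hH.radial_eq (e := e) (b := b) (σ := -1) (θ := -a) ha (norm_nonneg y)
    (by rw [abs_neg, abs_of_pos ha])
  rw [← hy, neg_one_mul] at h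
  rw [h]
  have h2 : 0 ≤ (a * ‖y‖) ^ k₁ * a := by positivity
  set l := b * ‖y‖ ^ 2 / a with hl
  have hlμ : -μ ≤ l := by rw [hl, le_div_iff₀ ha]; linarith
  have h3 : -(C * (1 + μ)) ≤ H e (l • outer e + (-1 : ℝ) • 1) := by
    have h4 : H e ((1 + μ) • (-1)) ≤ H e (l • outer e + (-1 : ℝ) • 1) := by
      refine hH.mono _ _ _ (Matrix.isSymm_one.neg.smul _)
        (((outer_isSymm e).smul l).add (Matrix.isSymm_one.smul _)) ?_
      have : l • outer e + (-1 : ℝ) • 1 - (1 + μ) • (-1 : Matrix (Fin n) (Fin n) ℝ) =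
          (l + μ) • outer e + μ • (1 - outer e) := by
        module
      rw [this]
      exact ((outer_posSemidef e).smul (by linarith)).add ((one_sub_outer_posSemidef he).smul hμ)
    rw [hH.homog_right _ _ _ (by linarith) Matrix.isSymm_one.neg] at h4
    nlinarith [mul_le_mul_of_nonneg_left (hC e he) (by linarith : 0 ≤ 1 + μ)]
  nlinarith [mul_le_mul_of_nonneg_left h3 h2]

theorem exists_neg_id_bound (hH : IsStructuralOperator H k₁) :
    ∃ C : ℝ, 0 ≤ C ∧ ∀ e : Rn n, ‖e‖ = 1 → -C ≤ H e (-1) := by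
  have hc : ContinuousOn (fun e : Rn n => H e (-1)) (Metric.sphere 0 1) :=
    hH.continuousOn.comp (f := fun e : Rn n => (e, (-1 : Matrix (Fin n) (Fin n) ℝ)))
      (by fun_prop) fun e _ => Matrix.isSymm_one.neg
  obtain ⟨m, hm⟩ := (isCompact_sphere (0 : Rn n) 1).bddBelow_image hc
  refine ⟨|m|, abs_nonneg m, fun e he => (neg_abs_le m).trans (hm ⟨e, by simpa using he, rfl⟩)⟩

end IsStructuralOperator

theorem exists_bound_of_lambdaSup_lt_top {n : ℕ} {H : Rn n → Matrix (Fin n) (Fin n) ℝ → ℝ}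
    (hΛ : LambdaSup H < ⊤) :
    ∃ Λ : ℝ, 0 ≤ Λ ∧ ∀ e : Rn n, ‖e‖ = 1 → ∀ l : ℝ, H e (l • outer e + 1) ≤ Λ := by
  obtain ⟨Λ, h1, -⟩ := EReal.lt_iff_exists_real_btwn.mp hΛ
  refine ⟨max Λ 0, le_max_right _ _, fun e he l => le_max_of_le_left ?_⟩
  have h2 : ((H e (l • outer e + 1) : ℝ) : EReal) ≤ LambdaSup H :=
    (le_iSup₂_of_le (f := fun e (_ : e ∈ Metric.sphere (0 : Rn n) 1) =>
      ((H e (l • outer e + 1) : ℝ) : EReal)) e (by simpa using he) le_rfl).trans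
      (le_iSup (fun l => LambdaMax H l) l)
  exact_mod_cast h2.trans h1.le

/-! ### The barrier and the reduction to interior contact. -/

/-- If an upper semicontinuous function exceeds a barrier which dominates it initially, far away
and near the final time, then their difference has a local maximum at an interior point. -/
theorem exists_isLocalMax_of_barrier {n : ℕ} {T : ℝ} {z : Rn n} {v B : Rn n → ℝ → ℝ}
    (hv : UpperSemicontinuousOn (fun p : Rn n × ℝ => v p.1 p.2) (univ ×ˢ Ico 0 T))
    (hB : ContinuousOn (fun p : Rn n × ℝ => B p.1 p.2) (univ ×ˢ Ico 0 T))
    (h0 : ∀ x, v x 0 ≤ B x 0)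
    (hfar : ∃ R, ∀ x, ∀ t ∈ Ioo 0 T, R ≤ ‖x - z‖ → v x t ≤ B x t)
    (hend : ∀ R, ∃ τ < T, ∀ x, ∀ t ∈ Ioo 0 T, ‖x - z‖ ≤ R → τ ≤ t → v x t ≤ B x t)
    {y : Rn n} {s : ℝ} (hs : s ∈ Ioo 0 T) (hlt : B y s < v y s) :
    ∃ x, ∃ t ∈ Ioo 0 T,
      IsLocalMax (fun p : Rn n × ℝ => v p.1 p.2 - B p.1 p.2) (x, t) := by
  obtain ⟨R, hR⟩ := hfar
  obtain ⟨τ, hτT, hτ⟩ := hend R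
  have hy : ‖y - z‖ < R := by
    by_contra! h
    exact hlt.not_ge (hR y s hs h)
  -- The final time must exceed every possible contact time (hence `τ`) and keep `(y, s)` inside
  -- (hence `s`). The maximum over `K` is positive, which keeps it off the initial, lateral and
  -- final faces.
  set K : Set (Rn n × ℝ) := Metric.closedBall z R ×ˢ Icc 0 (max τ s) with hK
  have hmax : max τ s < T := max_lt hτT hs.2
  have hKsub : K ⊆ univ ×ˢ Ico 0 T := fun p hp => ⟨trivial, hp.2.1, hp.2.2.trans_lt hmax⟩
  have hKc : IsCompact K := (isCompact_closedBall z R).prod isCompact_Icc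
  have hys : (y, s) ∈ K :=
    ⟨by simpa [dist_eq_norm] using hy.le, hs.1.le, le_max_right _ _⟩
  have husc : UpperSemicontinuousOn (fun p : Rn n × ℝ => v p.1 p.2 - B p.1 p.2) K := by
    have := (hv.mono hKsub).add (hB.mono hKsub).neg.upperSemicontinuousOn
    simpa [sub_eq_add_neg] using this
  obtain ⟨⟨x, t⟩, hxt, hm⟩ := husc.exists_isMaxOn ⟨_, hys⟩ hKc
  have hpos : B x t < v x t := by
    have := hm hys
    simp only [mem_ofPred_eq] at this
    linarith
  have ht0 : 0 < t := by
    rcases hxt.2.1.eq_or_lt with h | h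
    · have h' : (0 : ℝ) = t := h
      subst h'
      exact absurd (h0 x) hpos.not_ge
    · exact h
  have ht : t ∈ Ioo 0 T := ⟨ht0, (hKsub hxt).2.2⟩
  have hxR : ‖x - z‖ < R := by
    by_contra! h
    exact hpos.not_ge (hR x t ht h)
  have htτ : t < τ := by
    by_contra! h
    exact hpos.not_ge (hτ x t ht hxR.le h)
  refine ⟨x, t, ht, hm.isLocalMax ?_⟩
  exact prod_mem_nhds (Metric.closedBall_mem_nhds_of_mem (by simpa [dist_eq_norm] using hxR))
    (Icc_mem_nhds ht0 (htτ.trans_le (le_max_left _ _)))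

/-- The radial barrier `c(t) (1 + |x - z|²)^p + δ / (T - t)`. -/
noncomputable def barrier {n : ℕ} (z : Rn n) (T p δ : ℝ) (c : ℝ → ℝ) (x : Rn n) (t : ℝ) : ℝ :=
  c t * (1 + ‖x - z‖ ^ 2) ^ p + δ / (T - t)

theorem contDiffOn_barrier {n : ℕ} (z : Rn n) (T p δ : ℝ) {c : ℝ → ℝ} (hc : ContDiff ℝ 2 c) :
    ContDiffOn ℝ 2 (fun q : Rn n × ℝ => barrier z T p δ c q.1 q.2) {q | q.2 < T} := by
  have h1 : ContDiff ℝ 2 (fun q : Rn n × ℝ => (1 + ‖q.1 - z‖ ^ 2) ^ p) := by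
    refine ContDiff.rpow_const_of_ne ?_ fun q => by positivity
    exact contDiff_const.add ((contDiff_fst.sub contDiff_const).norm_sq ℝ)
  refine ContDiffOn.add ((hc.comp contDiff_snd).mul h1).contDiffOn ?_
  refine contDiffOn_const.div (contDiff_const.sub contDiff_snd).contDiffOn fun q hq => ?_
  have : q.2 < T := hq
  linarith

/-- Comparison with a function of the radial barrier, reduced to excluding interior contact. -/
theorem le_of_barrier {n : ℕ} {T p δ ε : ℝ} {z : Rn n} {c : ℝ → ℝ} {v B : Rn n → ℝ → ℝ}
    {η : ℝ → ℝ} (C : ℝ) (hδ : 0 < δ) (hε : 0 < ε) (hc : ∀ t ∈ Ioo 0 T, ε ≤ c t)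
    (hp : 0 < p)
    (hv : UpperSemicontinuousOn (fun q : Rn n × ℝ => v q.1 q.2) (univ ×ˢ Ico 0 T))
    (hB : ContinuousOn (fun q : Rn n × ℝ => B q.1 q.2) (univ ×ˢ Ico 0 T))
    (h0 : ∀ x, v x 0 ≤ B x 0)
    (hη : η =o[atTop] (fun R : ℝ => R ^ (2 * p)))
    (hgrow : ∀ᶠ R in atTop, ∀ q ∈ cylinder z R T,
      |η R| + C ≤ barrier z T p δ c q.1 q.2 → v q.1 q.2 ≤ B q.1 q.2)
    (hno : ∀ x, ∀ t ∈ Ioo 0 T,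
      ¬ IsLocalMax (fun q : Rn n × ℝ => v q.1 q.2 - B q.1 q.2) (x, t)) :
    ∀ x, ∀ t ∈ Ioo 0 T, v x t ≤ B x t := by
  intro y s hs
  by_contra! hlt
  have hw : ∀ x, ∀ t ∈ Ioo 0 T,
      ε * (‖x - z‖) ^ (2 * p) + δ / (T - t) ≤ barrier z T p δ c x t := by
    intro x t ht
    have h1 : ‖x - z‖ ^ (2 * p) ≤ (1 + ‖x - z‖ ^ 2) ^ p := by
      rw [Real.rpow_mul (norm_nonneg _), Real.rpow_two]
      exact Real.rpow_le_rpow (by positivity) (by linarith) hp.le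
    have h2 : ε * (‖x - z‖) ^ (2 * p) ≤ c t * (1 + ‖x - z‖ ^ 2) ^ p :=
      mul_le_mul (hc t ht) h1 (by positivity) (hε.le.trans (hc t ht))
    unfold barrier
    linarith
  have hfar : ∃ R, ∀ x, ∀ t ∈ Ioo 0 T, R ≤ ‖x - z‖ → v x t ≤ B x t := by
    have hlim : Tendsto (fun R : ℝ => ε / 2 * R ^ (2 * p)) atTop atTop :=
      (tendsto_rpow_atTop (by positivity)).const_mul_atTop (by positivity)
    -- Half of `ε R^{2p}` absorbs `|η R|`, the other half absorbs `C`.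
    have h1 := hη.def (half_pos hε)
    obtain ⟨R, hR⟩ := eventually_atTop.mp
      ((hgrow.and (h1.and (hlim.eventually_ge_atTop C))).and (eventually_ge_atTop 0))
    refine ⟨R, fun x t ht hx => ?_⟩
    obtain ⟨⟨h2, h3, h4⟩, h5⟩ := hR _ hx
    refine h2 (x, t) ⟨le_rfl, ht⟩ (le_trans ?_ (hw x t ht))
    have h6 : 0 ≤ δ / (T - t) := div_nonneg hδ.le (by linarith [ht.2])
    rw [Real.norm_eq_abs, Real.norm_of_nonneg (by positivity)] at h3
    linarith
  have hend : ∀ R, ∃ τ < T, ∀ x, ∀ t ∈ Ioo 0 T, ‖x - z‖ ≤ R → τ ≤ t → v x t ≤ B x t := by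
    intro R
    obtain ⟨R', hRR', h2⟩ := ((eventually_ge_atTop R).and hgrow).exists
    -- On a fixed ball the required height is a finite number, which `δ / (T - t)` alone exceeds
    -- near `T`.
    set D := |η R'| + |C| + 1 with hD
    have hDpos : 0 < D := by positivity
    refine ⟨T - δ / D, by linarith [div_pos hδ hDpos], fun x t ht hx htτ => ?_⟩
    refine h2 (x, t) ⟨hx.trans hRR', ht⟩ (le_trans ?_ (hw x t ht))
    have hTt : 0 < T - t := by linarith [ht.2]
    have h3 : D ≤ δ / (T - t) := by
      rw [le_div_iff₀ hTt]
      have : T - t ≤ δ / D := by linarith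
      rw [le_div_iff₀ hDpos] at this
      linarith
    have h4 : 0 ≤ ε * (‖x - z‖) ^ (2 * p) := by positivity
    linarith [le_abs_self C]
  obtain ⟨x, t, ht, hm⟩ := exists_isLocalMax_of_barrier hv hB h0 hfar hend hs hlt
  exact hno x t ht hm

theorem hasDerivAt_one_add_rpow (p : ℝ) {s : ℝ} (hs : -1 < s) :
    HasDerivAt (fun s : ℝ => (1 + s) ^ p) (p * (1 + s) ^ (p - 1)) s := by
  have h := ((hasDerivAt_id s).const_add 1).rpow_const (p := p)
    (Or.inl (by simp only [id]; linarith))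
  simpa using h

/-- Derivatives of the test function `Θ (σ w + m)`, where `w` is the radial barrier. -/
theorem barrier_comp_derivs {n : ℕ} {z : Rn n} {T p δ : ℝ} {c : ℝ → ℝ} (hc : ContDiff ℝ 2 c)
    {c' : ℝ} {x : Rn n} {t : ℝ} (ht : t < T) (hc' : HasDerivAt c c' t) (σ m : ℝ)
    {Θ Θ₁ : ℝ → ℝ} {Θ₂ : ℝ} {N : Set ℝ} (hN : IsOpen N) (hΘ : ContDiffOn ℝ 2 Θ N)
    (h₁ : ∀ τ ∈ N, HasDerivAt Θ (Θ₁ τ) τ) (hmem : σ * barrier z T p δ c x t + m ∈ N)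
    (h₂ : HasDerivAt Θ₁ Θ₂ (σ * barrier z T p δ c x t + m)) :
    ∃ U : Set (Rn n × ℝ), (x, t) ∈ U ∧
      IsC21On (fun y r => Θ (σ * barrier z T p δ c y r + m)) U ∧
      gradient (fun y => Θ (σ * barrier z T p δ c y t + m)) x =
        (2 * (Θ₁ (σ * barrier z T p δ c x t + m) *
          (σ * (c t * (p * (1 + ‖x - z‖ ^ 2) ^ (p - 1)))))) • (x - z) ∧
      spatialHessian (fun y r => Θ (σ * barrier z T p δ c y r + m)) x t =
        (2 * (Θ₁ (σ * barrier z T p δ c x t + m) *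
          (σ * (c t * (p * (1 + ‖x - z‖ ^ 2) ^ (p - 1)))))) • 1 +
        (4 * (Θ₂ * (σ * (c t * (p * (1 + ‖x - z‖ ^ 2) ^ (p - 1)))) ^ 2 +
          Θ₁ (σ * barrier z T p δ c x t + m) *
          (σ * (c t * (p * ((p - 1) * (1 + ‖x - z‖ ^ 2) ^ (p - 1 - 1))))))) • outer (x - z) ∧
      deriv (fun r => Θ (σ * barrier z T p δ c x r + m)) t =
        Θ₁ (σ * barrier z T p δ c x t + m) *
          (σ * (c' * (1 + ‖x - z‖ ^ 2) ^ p + δ / (T - t) ^ 2)) := by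
  set W : Rn n × ℝ → ℝ := fun q => σ * barrier z T p δ c q.1 q.2 + m with hW
  have hV : IsOpen {q : Rn n × ℝ | q.2 < T} := isOpen_lt continuous_snd continuous_const
  have hWc : ContDiffOn ℝ 2 W {q | q.2 < T} :=
    (contDiffOn_const.mul (contDiffOn_barrier z T p δ hc)).add contDiffOn_const
  have hU := hWc.continuousOn.isOpen_inter_preimage hV hN
  set S := ‖x - z‖ ^ 2 with hS
  have hS0 : 0 ≤ S := by positivity
  let ω : ℝ → ℝ := fun s => σ * (c t * (1 + s) ^ p + δ / (T - t)) + m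
  let ω₁ : ℝ → ℝ := fun s => σ * (c t * (p * (1 + s) ^ (p - 1)))
  have hω : ∀ s, -1 < s → HasDerivAt ω (ω₁ s) s := fun s hs =>
    ((((hasDerivAt_one_add_rpow p hs).const_mul (c t)).add_const _).const_mul σ).add_const m
  have hω₁ : HasDerivAt ω₁ (σ * (c t * (p * ((p - 1) * (1 + S) ^ (p - 1 - 1))))) S :=
    (((hasDerivAt_one_add_rpow (p - 1) (by linarith)).const_mul p).const_mul (c t)).const_mul σ
  have hωx : ω S = σ * barrier z T p δ c x t + m := rfl
  have hcω : ContinuousAt ω S := (hω S (by linarith)).continuousAt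
  have hev : ∀ᶠ s in 𝓝 S, HasDerivAt (fun s => Θ (ω s)) (Θ₁ (ω s) * ω₁ s) s := by
    filter_upwards [hcω.preimage_mem_nhds (hN.mem_nhds (hωx ▸ hmem)),
      lt_mem_nhds (show -1 < S by linarith)] with s hs1 hs2
    exact (h₁ _ hs1).comp s (hω s hs2)
  have hsec : HasDerivAt (fun s => Θ₁ (ω s) * ω₁ s)
      (Θ₂ * ω₁ S ^ 2 + Θ₁ (ω S) * (σ * (c t * (p * ((p - 1) * (1 + S) ^ (p - 1 - 1)))))) S := by
    refine (((HasDerivAt.comp S (by exact h₂) (hω S (by linarith)))).mul hω₁).congr_deriv ?_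
    simp only [Function.comp]
    ring
  obtain ⟨hg, hh⟩ := gradient_hessian_radial z x
    (ψ := fun y r => Θ (σ * barrier z T p δ c y r + m)) (t := t) (fun y => rfl) hev hsec
  refine ⟨{q | q.2 < T} ∩ W ⁻¹' N, ⟨ht, hmem⟩, isC21On_of_contDiffOn hU ?_, hg, hh, ?_⟩
  · exact hΘ.comp (hWc.mono inter_subset_left) fun q hq => hq.2
  · have hT : HasDerivAt (fun r : ℝ => δ / (T - r)) (δ / (T - t) ^ 2) t := by
      have hne : T - t ≠ 0 := by linarith
      refine ((hasDerivAt_const t δ).div ((hasDerivAt_id t).const_sub T) hne).congr_deriv ?_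
      simp
    exact ((h₁ _ hmem).comp t (((hc'.mul_const _).add hT).const_mul σ |>.add_const m)).deriv

/-! ### The viscosity inequalities at a contact point. -/

namespace IsStructuralOperator

variable {n : ℕ} {H : Rn n → Matrix (Fin n) (Fin n) ℝ → ℝ} {k₁ : ℝ}

/-- What a subsolution says at a point where it is touched from above by `Θ (w + m)`. -/
theorem subsolution_touching (hH : IsStructuralOperator H k₁) (hn : 2 ≤ n) {Λ : ℝ}
    (hΛ : ∀ e : Rn n, ‖e‖ = 1 → ∀ l : ℝ, H e (l • outer e + 1) ≤ Λ)
    {f : ℝ → ℝ} {u : Rn n → ℝ → ℝ} {z : Rn n} {T p δ : ℝ} {c : ℝ → ℝ}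
    (hu : IsViscositySubsolution H f T u) (hc : ContDiff ℝ 2 c) (hp : 0 < p)
    {c' : ℝ} {x : Rn n} {t : ℝ} (ht : t ∈ Ioo 0 T) (hct : 0 < c t) (hc' : HasDerivAt c c' t)
    (m : ℝ) {Θ Θ₁ : ℝ → ℝ} {Θ₂ : ℝ} {N : Set ℝ} (hN : IsOpen N) (hΘ : ContDiffOn ℝ 2 Θ N)
    (h₁ : ∀ τ ∈ N, HasDerivAt Θ (Θ₁ τ) τ) (hmem : 1 * barrier z T p δ c x t + m ∈ N)
    (hpos : 0 < Θ₁ (1 * barrier z T p δ c x t + m))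
    (h₂ : HasDerivAt Θ₁ Θ₂ (1 * barrier z T p δ c x t + m))
    (hmax : IsLocalMax (fun q : Rn n × ℝ =>
      u q.1 q.2 - Θ (1 * barrier z T p δ c q.1 q.2 + m)) (x, t)) :
    f (u x t) * (c' * (1 + ‖x - z‖ ^ 2) ^ p + δ / (T - t) ^ 2) ≤
      Λ * (Θ₁ (1 * barrier z T p δ c x t + m) ^ k₁ *
        ((2 * (c t * (p * (1 + ‖x - z‖ ^ 2) ^ (p - 1))) * ‖x - z‖) ^ k₁ *
          (2 * (c t * (p * (1 + ‖x - z‖ ^ 2) ^ (p - 1)))))) := by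
  obtain ⟨U, hxU, hψ, hg, hh, hd⟩ := barrier_comp_derivs hc ht.2 hc' 1 m hN hΘ h₁ hmem h₂
  have h := hu x t ht _ U hψ hxU hmax
  rw [hg, hh, hd] at h
  set Q := Θ₁ (1 * barrier z T p δ c x t + m)
  set A := 2 * (c t * (p * (1 + ‖x - z‖ ^ 2) ^ (p - 1))) with hA
  have hA0 : 0 < A := by positivity
  have ha : 2 * (Q * (1 * (c t * (p * (1 + ‖x - z‖ ^ 2) ^ (p - 1))))) = Q * A := by
    rw [hA]; ring
  rw [ha] at h
  have hle := h.trans (sub_le_sub_right (hH.radial_le hn hΛ (mul_pos hpos hA0) (x - z)) _)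
  rw [mul_assoc, Real.mul_rpow hpos.le (by positivity)] at hle
  -- The time derivative carries one factor `Q` and the operator carries `Q^{k₁+1}`; dividing leaves
  -- `Q^{k₁}`, which is later `f(u)` or `1`.
  refine le_of_mul_le_mul_left ?_ hpos
  linarith

/-- What a supersolution says at a point where it is touched from below by `Θ (-w + m)`. -/
theorem supersolution_touching (hH : IsStructuralOperator H k₁) (hn : 2 ≤ n) {C : ℝ}
    (hC : ∀ e : Rn n, ‖e‖ = 1 → -C ≤ H e (-1))
    {f : ℝ → ℝ} {u : Rn n → ℝ → ℝ} {z : Rn n} {T p δ : ℝ} {c : ℝ → ℝ}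
    (hu : IsViscositySupersolution H f T u) (hc : ContDiff ℝ 2 c) (hp : 0 < p)
    {c' : ℝ} {x : Rn n} {t : ℝ} (ht : t ∈ Ioo 0 T) (hct : 0 < c t) (hc' : HasDerivAt c c' t)
    (m : ℝ) {Θ Θ₁ : ℝ → ℝ} {Θ₂ : ℝ} {N : Set ℝ} (hN : IsOpen N) (hΘ : ContDiffOn ℝ 2 Θ N)
    (h₁ : ∀ τ ∈ N, HasDerivAt Θ (Θ₁ τ) τ) (hmem : -1 * barrier z T p δ c x t + m ∈ N)
    (hpos : 0 < Θ₁ (-1 * barrier z T p δ c x t + m))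
    (h₂ : HasDerivAt Θ₁ Θ₂ (-1 * barrier z T p δ c x t + m)) {κ : ℝ} (hκ : 0 ≤ κ)
    (hΘ₂ : -(κ * Θ₁ (-1 * barrier z T p δ c x t + m)) ≤ Θ₂)
    (hmin : IsLocalMin (fun q : Rn n × ℝ =>
      u q.1 q.2 - Θ (-1 * barrier z T p δ c q.1 q.2 + m)) (x, t)) :
    f (u x t) * (c' * (1 + ‖x - z‖ ^ 2) ^ p + δ / (T - t) ^ 2) ≤
      C * (1 + (2 * |p - 1| +
          κ * (2 * (c t * (p * (1 + ‖x - z‖ ^ 2) ^ (p - 1)))) * ‖x - z‖ ^ 2)) *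
        (Θ₁ (-1 * barrier z T p δ c x t + m) ^ k₁ *
        ((2 * (c t * (p * (1 + ‖x - z‖ ^ 2) ^ (p - 1))) * ‖x - z‖) ^ k₁ *
          (2 * (c t * (p * (1 + ‖x - z‖ ^ 2) ^ (p - 1)))))) := by
  obtain ⟨U, hxU, hψ, hg, hh, hd⟩ := barrier_comp_derivs hc ht.2 hc' (-1) m hN hΘ h₁ hmem h₂
  have h := hu x t ht _ U hψ hxU hmin
  rw [hg, hh, hd] at h
  set Q := Θ₁ (-1 * barrier z T p δ c x t + m)
  set S := ‖x - z‖ ^ 2 with hS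
  have hS0 : 0 ≤ S := by positivity
  set A := 2 * (c t * (p * (1 + S) ^ (p - 1))) with hA
  have hA0 : 0 < A := by positivity
  set D := c t * (p * ((p - 1) * (1 + S) ^ (p - 1 - 1))) with hD
  have ha : 2 * (Q * (-1 * (c t * (p * (1 + S) ^ (p - 1))))) = -(Q * A) := by
    rw [hA]; ring
  -- The Hessian of the barrier contributes `2|p - 1|` to the loss `μ` in `le_radial`; the bound on
  -- `Θ₂` contributes `κ A S`.
  have hDS : 2 * (D * S) ≤ |p - 1| * A := by
    have h3 : (1 + S) ^ (p - 1) = (1 + S) ^ (p - 1 - 1) * (1 + S) := by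
      rw [Real.rpow_sub_one (by positivity) (p - 1)]
      field_simp
    have h4 : (p - 1) * S ≤ |p - 1| * (1 + S) := by
      nlinarith [le_abs_self (p - 1), abs_nonneg (p - 1)]
    have h5 : 0 ≤ 2 * (c t * (p * (1 + S) ^ (p - 1 - 1))) := by positivity
    have h6 := mul_le_mul_of_nonneg_left h4 h5
    rw [hA, h3, hD]
    linarith
  have hsq : (-1 * (c t * (p * (1 + S) ^ (p - 1)))) ^ 2 = A ^ 2 / 4 := by rw [hA]; ring
  rw [ha, hsq] at h
  have hle := (sub_le_sub_right (hH.le_radial hn hC (b := 4 * (Θ₂ * (A ^ 2 / 4) + Q * (-1 * D)))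
    (μ := 2 * |p - 1| + κ * A * S) (mul_pos hpos hA0) (by positivity) (x - z) ?_) _).trans h
  · rw [mul_assoc Q A ‖x - z‖, Real.mul_rpow hpos.le (by positivity)] at hle
    refine le_of_mul_le_mul_left ?_ hpos
    linarith
  · rw [← hS]
    have h6 := mul_le_mul_of_nonneg_right hΘ₂ (by positivity : 0 ≤ A ^ 2 * S)
    have h7 := mul_le_mul_of_nonneg_left hDS hpos.le
    nlinarith

end IsStructuralOperator

/-! ### The primitive of `f^{-1/(k-1)}` and its local inverse. -/

/-- The primitive of `f^{-1/(k-1)}` on `(0,∞)` which vanishes at `1`. -/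
noncomputable def primitive (k : ℝ) (f : ℝ → ℝ) (s : ℝ) : ℝ :=
  ∫ σ in (1 : ℝ)..s, f σ ^ (-(1 / (k - 1)))

namespace IsAdmissibleNonlinearity

variable {k : ℝ} {f : ℝ → ℝ}

theorem contDiffAt (hf : IsAdmissibleNonlinearity k f) {s : ℝ} (hs : 0 < s) :
    ContDiffAt ℝ 1 f s :=
  hf.contDiffOn.contDiffAt (Ici_mem_nhds hs)

theorem contDiffAt_rpow (hf : IsAdmissibleNonlinearity k f) (a : ℝ) {s : ℝ} (hs : 0 < s) :
    ContDiffAt ℝ 1 (fun σ => f σ ^ a) s :=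
  (hf.contDiffAt hs).rpow_const_of_ne (hf.pos s hs).ne'

theorem hasDerivAt_primitive (hf : IsAdmissibleNonlinearity k f) {s : ℝ} (hs : 0 < s) :
    HasDerivAt (primitive k f) (f s ^ (-(1 / (k - 1)))) s := by
  have hc : ContinuousOn (fun σ => f σ ^ (-(1 / (k - 1)))) (Ioi 0) := fun σ hσ =>
    (hf.contDiffAt_rpow _ hσ).continuousAt.continuousWithinAt
  refine intervalIntegral.integral_hasDerivAt_right ?_ ?_
    (hf.contDiffAt_rpow _ hs).continuousAt
  · refine (hc.mono fun σ hσ => ?_).intervalIntegrable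
    exact (lt_min one_pos hs).trans_le hσ.1
  · exact hc.stronglyMeasurableAtFilter isOpen_Ioi s hs

theorem strictMonoOn_primitive (hf : IsAdmissibleNonlinearity k f) :
    StrictMonoOn (primitive k f) (Ioi 0) := by
  refine strictMonoOn_of_deriv_pos (convex_Ioi 0) (fun s hs =>
    (hf.hasDerivAt_primitive hs).continuousAt.continuousWithinAt) fun s hs => ?_
  rw [interior_Ioi] at hs
  rw [(hf.hasDerivAt_primitive hs).deriv]
  exact Real.rpow_pos_of_pos (hf.pos s hs) _

theorem contDiffAt_primitive (hf : IsAdmissibleNonlinearity k f) {s : ℝ} (hs : 0 < s) :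
    ContDiffAt ℝ 2 (primitive k f) s := by
  have : ContDiffOn ℝ 2 (primitive k f) (Ioi 0) := by
    rw [show (2 : WithTop ℕ∞) = 1 + 1 by norm_num, contDiffOn_succ_iff_deriv_of_isOpen isOpen_Ioi]
    refine ⟨fun s hs => (hf.hasDerivAt_primitive hs).differentiableAt.differentiableWithinAt,
      by simp, ?_⟩
    have h : ContDiffOn ℝ 1 (fun σ => f σ ^ (-(1 / (k - 1)))) (Ioi 0) := fun σ hσ =>
      (hf.contDiffAt_rpow _ hσ).contDiffWithinAt
    exact h.congr fun s hs => (hf.hasDerivAt_primitive hs).deriv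
  exact this.contDiffAt (Ioi_mem_nhds hs)

/-- A local `C²` inverse of the primitive; it is a convex solution of `Φ' = f(Φ)^{1/(k-1)}`. -/
theorem exists_local_inverse_primitive (hk : 1 < k) (hf : IsAdmissibleNonlinearity k f) {s : ℝ}
    (hs : 0 < s) :
    ∃ (Φ : ℝ → ℝ) (N : Set ℝ) (Φ₂ : ℝ), IsOpen N ∧ primitive k f s ∈ N ∧ ContDiffOn ℝ 2 Φ N ∧
      Φ (primitive k f s) = s ∧ (∀ τ ∈ N, 0 < Φ τ ∧ primitive k f (Φ τ) = τ) ∧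
      (∀ τ ∈ N, HasDerivAt Φ (f (Φ τ) ^ (1 / (k - 1))) τ) ∧
      HasDerivAt (fun τ => f (Φ τ) ^ (1 / (k - 1))) Φ₂ (primitive k f s) ∧ 0 ≤ Φ₂ := by
  have hG := hf.contDiffAt_primitive hs
  have hGd := hf.hasDerivAt_primitive hs
  have hne : f s ^ (-(1 / (k - 1))) ≠ 0 := (Real.rpow_pos_of_pos (hf.pos s hs) _).ne'
  have hGd' : HasFDerivAt (primitive k f)
      ((ContinuousLinearEquiv.unitsEquivAut ℝ (Units.mk0 _ hne) : ℝ ≃L[ℝ] ℝ) : ℝ →L[ℝ] ℝ) s := by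
    refine hGd.hasFDerivAt.congr_fderiv ?_
    ext
    simp
  set Φ := hG.localInverse hGd' (by norm_num) with hΦ
  have hΦs : Φ (primitive k f s) = s :=
    hG.localInverse_apply_image hGd' (by norm_num)
  have hΦc : ContDiffAt ℝ 2 Φ (primitive k f s) := hG.to_localInverse hGd' (by norm_num)
  have hright : ∀ᶠ τ in 𝓝 (primitive k f s), primitive k f (Φ τ) = τ :=
    (hG.hasStrictFDerivAt' hGd' (by norm_num)).eventually_right_inverse
  have hposev : ∀ᶠ τ in 𝓝 (primitive k f s), 0 < Φ τ :=
    hΦc.continuousAt.eventually (by rw [hΦs]; exact lt_mem_nhds hs)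
  have hcev : ∀ᶠ τ in 𝓝 (primitive k f s), ContDiffAt ℝ 2 Φ τ :=
    hΦc.eventually (by norm_num)
  obtain ⟨N, hNall, hNo, hNs⟩ := eventually_nhds_iff.mp (hright.and (hposev.and hcev))
  have hder : ∀ τ ∈ N, HasDerivAt Φ (f (Φ τ) ^ (1 / (k - 1))) τ := by
    intro τ hτ
    obtain ⟨h1, h2, h3⟩ := hNall τ hτ
    have h4 := HasDerivAt.of_local_left_inverse (f := primitive k f) (g := Φ) h3.continuousAt
      (hf.hasDerivAt_primitive h2) (Real.rpow_pos_of_pos (hf.pos _ h2) _).ne'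
      (by filter_upwards [hNo.mem_nhds hτ] with r hr using (hNall r hr).1)
    rwa [Real.rpow_neg (hf.pos _ h2).le, inv_inv] at h4
  have hsec : DifferentiableAt ℝ (fun τ => f (Φ τ) ^ (1 / (k - 1))) (primitive k f s) := by
    have h1 : DifferentiableAt ℝ (fun σ => f σ ^ (1 / (k - 1))) (Φ (primitive k f s)) := by
      rw [hΦs]
      exact (hf.contDiffAt_rpow _ hs).differentiableAt (by norm_num)
    exact h1.comp (primitive k f s) (hΦc.differentiableAt (by norm_num))
  refine ⟨Φ, N, _, hNo, hNs, fun τ hτ => (hNall τ hτ).2.2.contDiffWithinAt, hΦs,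
    fun τ hτ => ⟨(hNall τ hτ).2.1, (hNall τ hτ).1⟩, hder, hsec.hasDerivAt, ?_⟩
  -- `Φ₂ ≥ 0` because `Φ' = f(Φ)^{1/(k-1)}` is a composition of nondecreasing maps.
  have hmonoΦ : MonotoneOn Φ N := fun τ hτ r hr h => by
    by_contra! hlt
    have := hf.strictMonoOn_primitive (hNall r hr).2.1 (hNall τ hτ).2.1 hlt
    rw [(hNall r hr).1, (hNall τ hτ).1] at this
    exact this.not_ge h
  have hmono : MonotoneOn (fun τ => f (Φ τ) ^ (1 / (k - 1))) N := fun τ hτ r hr h =>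
    Real.rpow_le_rpow (hf.nonneg _ (hNall τ hτ).2.1.le)
      (hf.monotoneOn (hNall τ hτ).2.1.le (hNall r hr).2.1.le (hmonoΦ hτ hr h))
      (one_div_nonneg.mpr (by linarith))
  rw [← derivWithin_of_isOpen hNo hNs]
  exact hmono.derivWithin_nonneg

/-- The derivatives `f^{-1/(k-1)}` and `f^{1/(k-1)}` cancel. This turns a growth bound by `φ(η)`
into a bound on the primitive by `η` plus a constant. -/
theorem primitive_comp_eq (hf : IsAdmissibleNonlinearity k f) {φ : ℝ → ℝ} {J : Set ℝ}
    (hJ : IsOpen J) (hJc : Convex ℝ J) (hpos : ∀ τ ∈ J, 0 < φ τ)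
    (hφ : ∀ τ ∈ J, HasDerivAt φ (f (φ τ) ^ (1 / (k - 1))) τ) :
    ∃ C : ℝ, ∀ τ ∈ J, primitive k f (φ τ) = τ + C := by
  have hd : ∀ τ ∈ J, HasDerivAt (fun τ => primitive k f (φ τ) - τ) 0 τ := by
    intro τ hτ
    have h := ((hf.hasDerivAt_primitive (hpos τ hτ)).comp τ (hφ τ hτ)).sub (hasDerivAt_id τ)
    rw [← Real.rpow_add (hf.pos _ (hpos τ hτ)), neg_add_cancel, Real.rpow_zero, sub_self] at h
    exact h
  obtain ⟨C, hC⟩ := hJ.exists_is_const_of_deriv_eq_zero hJc.isPreconnected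
    (fun τ hτ => (hd τ hτ).differentiableAt.differentiableWithinAt) fun τ hτ => (hd τ hτ).deriv
  exact ⟨C, fun τ hτ => by linarith [hC τ hτ]⟩

end IsAdmissibleNonlinearity

/-! ### The critical exponent and the contradiction at contact. -/

/-- The powers of `1 + r²` add up to `(p - 1/2) k₁ + (p - 1)`, which equals `p` exactly when `2p =
γ*`. -/
theorem radial_rate_le {k k₁ p c r : ℝ} (hk : 1 < k) (hk₁ : k = k₁ + 1)
    (hp : 2 * p = (k + 1) / (k - 1)) (hc : 0 < c) (hr : 0 ≤ r) :
    (2 * (c * (p * (1 + r ^ 2) ^ (p - 1))) * r) ^ k₁ * (2 * (c * (p * (1 + r ^ 2) ^ (p - 1)))) ≤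
      (2 * p * c) ^ k * (1 + r ^ 2) ^ p := by
  have hk' : 0 < k - 1 := by linarith
  have hp0 : 0 < p := by
    have : 0 < 2 * p := hp ▸ div_pos (by linarith) hk'
    linarith
  have hS : 0 < 1 + r ^ 2 := by positivity
  have hr' : r ≤ (1 + r ^ 2) ^ (1 / 2 : ℝ) := by
    rw [← Real.sqrt_eq_rpow]
    exact Real.le_sqrt_of_sq_le (by linarith)
  have h1 : 2 * (c * (p * (1 + r ^ 2) ^ (p - 1))) * r ≤ 2 * p * c * (1 + r ^ 2) ^ (p - 1 / 2) := by
    have : (1 + r ^ 2) ^ (p - 1 / 2) = (1 + r ^ 2) ^ (p - 1) * (1 + r ^ 2) ^ (1 / 2 : ℝ) := by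
      rw [← Real.rpow_add hS]
      ring_nf
    rw [this]
    have h2 : 0 ≤ 2 * p * c * (1 + r ^ 2) ^ (p - 1) := by positivity
    nlinarith [mul_le_mul_of_nonneg_left hr' h2]
  have h2 := Real.rpow_le_rpow (by positivity) h1 (show 0 ≤ k₁ by linarith)
  refine (mul_le_mul_of_nonneg_right h2 (by positivity)).trans_eq ?_
  have h3 : (p - 1 / 2) * k₁ + (p - 1) = p := by
    rw [eq_div_iff hk'.ne'] at hp
    have : k₁ = k - 1 := by linarith
    rw [this]
    linarith
  calc (2 * p * c * (1 + r ^ 2) ^ (p - 1 / 2)) ^ k₁ * (2 * (c * (p * (1 + r ^ 2) ^ (p - 1))))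
      = ((2 * p * c) ^ k₁ * (2 * p * c)) *
          ((1 + r ^ 2) ^ ((p - 1 / 2) * k₁) * (1 + r ^ 2) ^ (p - 1)) := by
        rw [Real.mul_rpow (by positivity) (by positivity), ← Real.rpow_mul hS.le]
        ring
    _ = _ := by
        rw [← Real.rpow_add hS, h3, hk₁, Real.rpow_add_one (by positivity)]

theorem eventually_mul_rpow_le {k : ℝ} (hk : 1 < k) (K : ℝ) {a : ℝ} (ha : 0 ≤ a) :
    ∀ᶠ ε in 𝓝[>] (0 : ℝ), K * (a * ε) ^ k ≤ ε := by
  have h1 : Tendsto (fun ε : ℝ => K * a ^ k * ε ^ (k - 1)) (𝓝[>] 0) (𝓝 0) := by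
    have : ContinuousAt (fun ε : ℝ => K * a ^ k * ε ^ (k - 1)) 0 :=
      continuousAt_const.mul (Real.continuousAt_rpow_const _ _ (Or.inr (by linarith)))
    have h2 := this.tendsto
    rw [Real.zero_rpow (by linarith), mul_zero] at h2
    exact h2.mono_left nhdsWithin_le_nhds
  filter_upwards [h1.eventually_le_const one_pos, self_mem_nhdsWithin] with ε h2 h3
  have h3 : 0 < ε := h3
  calc K * (a * ε) ^ k = K * a ^ k * ε ^ (k - 1) * ε := by
        rw [Real.mul_rpow ha h3.le, mul_assoc (K * a ^ k), ← Real.rpow_add_one h3.ne',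
          sub_add_cancel]
        ring
    _ ≤ 1 * ε := mul_le_mul_of_nonneg_right h2 h3.le
    _ = ε := one_mul ε

/-- Here `Q^{k₁} = f(u)`, so the nonlinearity cancels. The smallness of `ε` balances the remaining
terms, and `δ / (T - t)²` makes the contradiction strict. -/
theorem touching_absurd {k k₁ p K ε T t δ r F Q : ℝ} (hk : 1 < k) (hk₁ : k = k₁ + 1)
    (hp : 2 * p = (k + 1) / (k - 1)) (hK : 0 ≤ K) (hε : 0 < ε) (hδ : 0 < δ)
    (hsmall : K * (2 * p * (1 + T) * ε) ^ k ≤ ε) (ht : t ∈ Ioo 0 T) (hr : 0 ≤ r) (hF : 0 < F)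
    (hQ : Q = F ^ (1 / (k - 1)))
    (h : F * (ε * (1 + r ^ 2) ^ p + δ / (T - t) ^ 2) ≤
      K * (Q ^ k₁ * ((2 * (ε * (1 + t) * (p * (1 + r ^ 2) ^ (p - 1))) * r) ^ k₁ *
          (2 * (ε * (1 + t) * (p * (1 + r ^ 2) ^ (p - 1))))))) : False := by
  have hk' : 0 < k - 1 := by linarith
  have hp0 : 0 < p := by
    have : 0 < 2 * p := hp ▸ div_pos (by linarith) hk'
    linarith
  have ht0 : 0 < 1 + t := by linarith [ht.1]
  have hTt : 0 < T - t := by linarith [ht.2]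
  have hQF : Q ^ k₁ = F := by
    rw [hQ, ← Real.rpow_mul hF.le, show 1 / (k - 1) * k₁ = 1 by
      rw [show k₁ = k - 1 by linarith]; field_simp, Real.rpow_one]
  have h1 := radial_rate_le hk hk₁ hp (mul_pos hε ht0) hr
  have h2 : (2 * p * (ε * (1 + t))) ^ k ≤ (2 * p * (1 + T) * ε) ^ k := by
    refine Real.rpow_le_rpow (by positivity) ?_ (by linarith)
    have : 2 * p * ε * (1 + t) ≤ 2 * p * ε * (1 + T) :=
      mul_le_mul_of_nonneg_left (by linarith [ht.2]) (by positivity)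
    linarith
  have hS : 0 ≤ (1 + r ^ 2) ^ p := by positivity
  have h3 := mul_le_mul_of_nonneg_left (h1.trans (mul_le_mul_of_nonneg_right h2 hS)) hK
  have h4 := mul_le_mul_of_nonneg_right hsmall hS
  have h5 : 0 < δ / (T - t) ^ 2 := by positivity
  rw [hQF, mul_left_comm] at h
  have h6 := le_of_mul_le_mul_left h hF
  linarith

/-! ### Semicontinuity under the change of variable. -/

theorem upperSemicontinuousOn_comp {X : Type*} [TopologicalSpace X] {S : Set X}
    {u : X → ℝ} {G : ℝ → ℝ} (hu : UpperSemicontinuousOn u S) (hpos : ∀ p ∈ S, 0 < u p)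
    (hG : MonotoneOn G (Ioi 0)) (hGc : ContinuousOn G (Ioi 0)) :
    UpperSemicontinuousOn (fun p => G (u p)) S := by
  intro p hp y hy
  have h1 : ∀ᶠ s in 𝓝 (u p), G s < y :=
    (hGc.continuousAt (Ioi_mem_nhds (hpos p hp))).eventually (gt_mem_nhds hy)
  obtain ⟨s, hs1, hs2⟩ := ((h1.filter_mono nhdsWithin_le_nhds).and
    (self_mem_nhdsWithin (s := Ioi (u p)))).exists
  have hs2 : u p < s := hs2
  filter_upwards [hu p hp s hs2, self_mem_nhdsWithin] with q hq hqS
  exact (hG (hpos q hqS) ((hpos p hp).trans hs2) hq.le).trans_lt hs1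

theorem upperSemicontinuousOn_neg_comp {X : Type*} [TopologicalSpace X] {S : Set X}
    {u : X → ℝ} {G : ℝ → ℝ} (hu : LowerSemicontinuousOn u S) (hpos : ∀ p ∈ S, 0 < u p)
    (hG : MonotoneOn G (Ioi 0)) (hGc : ContinuousOn G (Ioi 0)) :
    UpperSemicontinuousOn (fun p => -G (u p)) S := by
  intro p hp y hy
  have h1 : ∀ᶠ s in 𝓝 (u p), -y < G s ∧ 0 < s :=
    ((hGc.continuousAt (Ioi_mem_nhds (hpos p hp))).eventually
      (lt_mem_nhds (by linarith))).and (lt_mem_nhds (hpos p hp))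
  obtain ⟨s, ⟨hs1, hs0⟩, hs2⟩ := ((h1.filter_mono nhdsWithin_le_nhds).and
    (self_mem_nhdsWithin (s := Iio (u p)))).exists
  have hs2 : s < u p := hs2
  filter_upwards [hu p hp s hs2, self_mem_nhdsWithin] with q hq hqS
  have h3 : G s ≤ G (u q) := hG hs0 (hpos q hqS) hq.le
  show -G (u q) < y
  linarith

theorem closedStrip_mem_nhds {n : ℕ} {T t : ℝ} (x : Rn n) (ht : t ∈ Ioo 0 T) :
    closedStrip n T ∈ 𝓝 (x, t) :=
  prod_mem_nhds univ_mem (Icc_mem_nhds ht.1 ht.2)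

theorem univ_prod_Ico_subset_closedStrip (n : ℕ) (T : ℝ) :
    (univ ×ˢ Ico 0 T : Set (Rn n × ℝ)) ⊆ closedStrip n T :=
  prod_mono_right Ico_subset_Icc_self

theorem continuousOn_barrier {n : ℕ} (z : Rn n) (T p δ : ℝ) {c : ℝ → ℝ} (hc : ContDiff ℝ 2 c) :
    ContinuousOn (fun q : Rn n × ℝ => barrier z T p δ c q.1 q.2) (univ ×ˢ Ico 0 T) :=
  (contDiffOn_barrier z T p δ hc).continuousOn.mono fun _ hq => hq.2.2

/-! ### The case `k > 1`. -/

section DegenerateCase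

variable {n : ℕ} {H : Rn n → Matrix (Fin n) (Fin n) ℝ → ℝ} {k k₁ : ℝ} {T : ℝ}

theorem barrier_limit (z x : Rn n) (p t a : ℝ) {b : ℝ}
    (h : ∀ᶠ ε in 𝓝[>] (0 : ℝ), b ≤ a + barrier z T p ε (fun s => ε * (1 + s)) x t) : b ≤ a := by
  have hc : Continuous (fun ε : ℝ => a + barrier z T p ε (fun s => ε * (1 + s)) x t) := by
    unfold barrier
    fun_prop
  have h1 := hc.tendsto 0
  simp only [barrier, zero_mul, zero_div, add_zero] at h1
  exact ge_of_tendsto (h1.mono_left nhdsWithin_le_nhds) h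

theorem maximum_principle_of_one_lt (hT : 0 < T) (hn : 2 ≤ n) (hH : IsStructuralOperator H k₁)
    (hΛ : LambdaSup H < ⊤) (hk : 1 < k) (hk₁ : k = k₁ + 1) {f : ℝ → ℝ}
    (hf : IsAdmissibleNonlinearity k f) {u : Rn n → ℝ → ℝ}
    (hu : UpperSemicontinuousOn (fun p : Rn n × ℝ => u p.1 p.2) (closedStrip n T))
    (hpos : ∀ p ∈ closedStrip n T, 0 < u p.1 p.2) (hsub : IsViscositySubsolution H f T u)
    {M : ℝ} (hM : 0 < M) (h0 : ∀ x, u x 0 ≤ M) {z : Rn n} {η : ℝ → ℝ} {C : ℝ}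
    (hη : η =o[atTop] (fun R : ℝ => R ^ ((k + 1) / (k - 1))))
    (hgrow : ∀ᶠ R in atTop, ∀ q ∈ cylinder z R T, primitive k f (u q.1 q.2) ≤ |η R| + C) :
    ∀ x, ∀ t ∈ Ioo 0 T, u x t ≤ M := by
  obtain ⟨Λ, hΛ0, hΛ⟩ := exists_bound_of_lambdaSup_lt_top hΛ
  obtain ⟨p, hp⟩ : ∃ p, 2 * p = (k + 1) / (k - 1) := ⟨(k + 1) / (k - 1) / 2, by ring⟩
  have hp0 : 0 < p := by
    have : 0 < 2 * p := hp ▸ div_pos (by linarith) (by linarith)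
    linarith
  rw [← hp] at hη
  have hmono := hf.strictMonoOn_primitive
  have hcont : ContinuousOn (primitive k f) (Ioi 0) := fun s hs =>
    (hf.hasDerivAt_primitive hs).continuousAt.continuousWithinAt
  have hv := (upperSemicontinuousOn_comp hu hpos hmono.monotoneOn hcont).mono
    (univ_prod_Ico_subset_closedStrip n T)
  intro y s hs
  refine (hmono.le_iff_le (hpos (y, s) ⟨trivial, hs.1.le, hs.2.le⟩) hM).mp ?_
  refine barrier_limit (T := T) z y p s _ ?_
  filter_upwards [eventually_mul_rpow_le hk Λ (show 0 ≤ 2 * p * (1 + T) by positivity),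
    self_mem_nhdsWithin] with ε hsmall hε
  have hε : 0 < ε := hε
  have hc : ContDiff ℝ 2 (fun s : ℝ => ε * (1 + s)) := by fun_prop
  refine le_of_barrier (z := z) (c := fun s => ε * (1 + s)) (η := η)
    (v := fun x t => primitive k f (u x t)) (p := p)
    (B := fun x t => primitive k f M + barrier z T p ε (fun s => ε * (1 + s)) x t)
    (C - primitive k f M) hε hε (fun t ht => ?_) hp0 hv
    (continuousOn_const.add (continuousOn_barrier z T p ε hc)) (fun x => ?_) hη ?_ ?_ y s hs
  · nlinarith [ht.1]
  · have h1 : primitive k f (u x 0) ≤ primitive k f M :=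
      hmono.monotoneOn (hpos (x, 0) ⟨trivial, le_rfl, hT.le⟩) hM (h0 x)
    have h2 : 0 ≤ barrier z T p ε (fun s => ε * (1 + s)) x 0 := by
      unfold barrier
      rw [sub_zero]
      positivity
    linarith
  · filter_upwards [hgrow] with R hR q hq hle
    linarith [hR q hq]
  · intro x t ht hmax
    have hxt : 0 < u x t := hpos (x, t) ⟨trivial, ht.1.le, ht.2.le⟩
    obtain ⟨Φ, N, Φ₂, hN, hmem, hΦ, hΦx, hΦN, hd, hd₂, -⟩ :=
      hf.exists_local_inverse_primitive hk hxt
    set w := barrier z T p ε (fun s => ε * (1 + s)) with hw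
    -- The shift `m` raises the barrier to contact, so that `Φ (w + m)` equals `u` at `(x, t)` and,
    -- `G` being increasing, touches `u` from above.
    obtain ⟨m, hm⟩ : ∃ m, 1 * w x t + m = primitive k f (u x t) :=
      ⟨primitive k f (u x t) - 1 * w x t, by ring⟩
    have hc' : HasDerivAt (fun s : ℝ => ε * (1 + s)) ε t := by
      simpa using ((hasDerivAt_id t).const_add 1).const_mul ε
    have hwc : ContinuousAt (fun q : Rn n × ℝ => 1 * w q.1 q.2 + m) (x, t) :=
      (continuousAt_const.mul ((contDiffOn_barrier z T p ε hc).continuousOn.continuousAt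
        ((isOpen_lt continuous_snd continuous_const).mem_nhds ht.2))).add continuousAt_const
    have htouch : IsLocalMax (fun q : Rn n × ℝ => u q.1 q.2 - Φ (1 * w q.1 q.2 + m)) (x, t) := by
      have hNev := hwc.preimage_mem_nhds (hN.mem_nhds (hm ▸ hmem))
      filter_upwards [hmax, hNev, closedStrip_mem_nhds x ht] with q hq hqN hqS
      rw [hm, hΦx, sub_self, sub_nonpos]
      obtain ⟨h1, h2⟩ := hΦN _ hqN
      refine (hmono.le_iff_le (hpos q hqS) h1).mp ?_
      rw [h2]
      linarith
    have h := hH.subsolution_touching hn hΛ hsub hc hp0 ht (by nlinarith [ht.1]) hc' m hN hΦ hd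
      (by rw [hm]; exact hmem) (by rw [hm, hΦx]; exact Real.rpow_pos_of_pos (hf.pos _ hxt) _)
      (by rw [hm]; exact hd₂) htouch
    rw [hm, hΦx] at h
    exact touching_absurd hk hk₁ hp hΛ0 hε hε hsmall ht (norm_nonneg _) (hf.pos _ hxt) rfl h

theorem minimum_principle_of_one_lt (hT : 0 < T) (hn : 2 ≤ n) (hH : IsStructuralOperator H k₁)
    (hk : 1 < k) (hk₁ : k = k₁ + 1) {f : ℝ → ℝ}
    (hf : IsAdmissibleNonlinearity k f) {u : Rn n → ℝ → ℝ}
    (hu : LowerSemicontinuousOn (fun p : Rn n × ℝ => u p.1 p.2) (closedStrip n T))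
    (hpos : ∀ p ∈ closedStrip n T, 0 < u p.1 p.2) (hsup : IsViscositySupersolution H f T u)
    {M : ℝ} (hM : 0 < M) (h0 : ∀ x, M ≤ u x 0) {z : Rn n} {η : ℝ → ℝ} {C : ℝ}
    (hη : η =o[atTop] (fun R : ℝ => R ^ ((k + 1) / (k - 1))))
    (hgrow : ∀ᶠ R in atTop, ∀ q ∈ cylinder z R T, -primitive k f (u q.1 q.2) ≤ |η R| + C) :
    ∀ x, ∀ t ∈ Ioo 0 T, M ≤ u x t := by
  obtain ⟨K, hK0, hK⟩ := hH.exists_neg_id_bound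
  obtain ⟨p, hp⟩ : ∃ p, 2 * p = (k + 1) / (k - 1) := ⟨(k + 1) / (k - 1) / 2, by ring⟩
  have hp0 : 0 < p := by
    have : 0 < 2 * p := hp ▸ div_pos (by linarith) (by linarith)
    linarith
  rw [← hp] at hη
  have hmono := hf.strictMonoOn_primitive
  have hcont : ContinuousOn (primitive k f) (Ioi 0) := fun s hs =>
    (hf.hasDerivAt_primitive hs).continuousAt.continuousWithinAt
  have hv := (upperSemicontinuousOn_neg_comp hu hpos hmono.monotoneOn hcont).mono
    (univ_prod_Ico_subset_closedStrip n T)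
  intro y s hs
  refine (hmono.le_iff_le hM (hpos (y, s) ⟨trivial, hs.1.le, hs.2.le⟩)).mp (neg_le_neg_iff.mp ?_)
  refine barrier_limit (T := T) z y p s _ ?_
  have hK' : 0 ≤ K * (1 + 2 * |p - 1|) := by positivity
  filter_upwards [eventually_mul_rpow_le hk (K * (1 + 2 * |p - 1|))
    (show 0 ≤ 2 * p * (1 + T) by positivity), self_mem_nhdsWithin] with ε hsmall hε
  have hε : 0 < ε := hε
  have hc : ContDiff ℝ 2 (fun s : ℝ => ε * (1 + s)) := by fun_prop
  refine le_of_barrier (z := z) (c := fun s => ε * (1 + s)) (η := η)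
    (v := fun x t => -primitive k f (u x t)) (p := p)
    (B := fun x t => -primitive k f M + barrier z T p ε (fun s => ε * (1 + s)) x t)
    (C + primitive k f M) hε hε (fun t ht => ?_) hp0 hv
    (continuousOn_const.add (continuousOn_barrier z T p ε hc)) (fun x => ?_) hη ?_ ?_ y s hs
  · nlinarith [ht.1]
  · have h1 : primitive k f M ≤ primitive k f (u x 0) :=
      hmono.monotoneOn hM (hpos (x, 0) ⟨trivial, le_rfl, hT.le⟩) (h0 x)
    have h2 : 0 ≤ barrier z T p ε (fun s => ε * (1 + s)) x 0 := by
      unfold barrier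
      rw [sub_zero]
      positivity
    linarith
  · filter_upwards [hgrow] with R hR q hq hle
    linarith [hR q hq]
  · intro x t ht hmax
    have hxt : 0 < u x t := hpos (x, t) ⟨trivial, ht.1.le, ht.2.le⟩
    obtain ⟨Φ, N, Φ₂, hN, hmem, hΦ, hΦx, hΦN, hd, hd₂, hΦ₂⟩ :=
      hf.exists_local_inverse_primitive hk hxt
    set w := barrier z T p ε (fun s => ε * (1 + s)) with hw
    obtain ⟨m, hm⟩ : ∃ m, -1 * w x t + m = primitive k f (u x t) :=
      ⟨primitive k f (u x t) - -1 * w x t, by ring⟩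
    have hc' : HasDerivAt (fun s : ℝ => ε * (1 + s)) ε t := by
      simpa using ((hasDerivAt_id t).const_add 1).const_mul ε
    have hwc : ContinuousAt (fun q : Rn n × ℝ => -1 * w q.1 q.2 + m) (x, t) :=
      (continuousAt_const.mul ((contDiffOn_barrier z T p ε hc).continuousOn.continuousAt
        ((isOpen_lt continuous_snd continuous_const).mem_nhds ht.2))).add continuousAt_const
    have htouch : IsLocalMin (fun q : Rn n × ℝ => u q.1 q.2 - Φ (-1 * w q.1 q.2 + m)) (x, t) := by
      have hNev := hwc.preimage_mem_nhds (hN.mem_nhds (hm ▸ hmem))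
      filter_upwards [hmax, hNev, closedStrip_mem_nhds x ht] with q hq hqN hqS
      rw [hm, hΦx, sub_self, sub_nonneg]
      obtain ⟨h1, h2⟩ := hΦN _ hqN
      refine (hmono.le_iff_le h1 (hpos q hqS)).mp ?_
      rw [h2]
      linarith
    -- Convexity of `Φ` allows `κ = 0`; only the barrier's own Hessian contributes the factor `1 +
    -- 2|p - 1|`.
    have h := hH.supersolution_touching hn hK hsup hc hp0 ht (by nlinarith [ht.1]) hc' m hN hΦ hd
      (by rw [hm]; exact hmem) (by rw [hm, hΦx]; exact Real.rpow_pos_of_pos (hf.pos _ hxt) _)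
      (by rw [hm]; exact hd₂) le_rfl (by simpa using hΦ₂) htouch
    rw [hm, hΦx] at h
    simp only [zero_mul, add_zero] at h
    exact touching_absurd hk hk₁ hp hK' hε hε hsmall ht (norm_nonneg _) (hf.pos _ hxt) rfl h

end DegenerateCase

/-! ### The case `k = 1`. -/

section LinearCase

variable {n : ℕ} {H : Rn n → Matrix (Fin n) (Fin n) ℝ → ℝ} {T : ℝ}

/-- The logarithm makes `δ exp w ≥ (1 + |M|) exp |η|`, which covers both `exp η` and a negative `M`.
-/
theorem exp_barrier_growth {η w M δ : ℝ} (hδ : 0 < δ)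
    (h : |η| + Real.log ((1 + |M|) / δ) ≤ w) : Real.exp η ≤ M + δ * Real.exp w := by
  have hM : 0 < (1 + |M|) / δ := by positivity
  have h1 := Real.exp_le_exp.mpr h
  rw [Real.exp_add, Real.exp_log hM] at h1
  have h2 : Real.exp |η| * (1 + |M|) ≤ δ * Real.exp w := by
    have := mul_le_mul_of_nonneg_left h1 hδ.le
    calc Real.exp |η| * (1 + |M|) = δ * (Real.exp |η| * ((1 + |M|) / δ)) := by field_simp
      _ ≤ _ := this
  have h3 : Real.exp η ≤ Real.exp |η| := Real.exp_le_exp.mpr (le_abs_self η)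
  have h4 : 1 ≤ Real.exp |η| := Real.one_le_exp (abs_nonneg η)
  nlinarith [neg_abs_le M, abs_nonneg M]

theorem le_of_forall_pos_le_add_mul {a b e : ℝ}
    (h : ∀ δ > 0, b ≤ a + δ * e) : b ≤ a := by
  have hc : Continuous (fun δ : ℝ => a + δ * e) := by fun_prop
  have h1 := hc.tendsto 0
  rw [zero_mul, add_zero] at h1
  refine ge_of_tendsto (h1.mono_left (nhdsWithin_le_nhds (s := Ioi 0))) ?_
  filter_upwards [self_mem_nhdsWithin] with δ hδ using h δ hδ

theorem hasDerivAt_exp_rate (K T t : ℝ) :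
    HasDerivAt (fun s : ℝ => Real.exp (K * (s - T))) (K * Real.exp (K * (t - T))) t := by
  have := (((hasDerivAt_id t).sub_const T).const_mul K).exp
  simpa [mul_comm] using this

theorem maximum_principle_linear (hn : 2 ≤ n) (hH : IsStructuralOperator H 0)
    (hΛ : LambdaSup H < ⊤) {u : Rn n → ℝ → ℝ}
    (hu : UpperSemicontinuousOn (fun p : Rn n × ℝ => u p.1 p.2) (closedStrip n T))
    (hsub : IsViscositySubsolution H (fun _ => 1) T u)
    {M : ℝ} (h0 : ∀ x, u x 0 ≤ M) {z : Rn n} {η : ℝ → ℝ}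
    (hη : η =o[atTop] (fun R : ℝ => R ^ 2))
    (hgrow : ∀ᶠ R in atTop, ∀ q ∈ cylinder z R T, u q.1 q.2 ≤ Real.exp (η R)) :
    ∀ x, ∀ t ∈ Ioo 0 T, u x t ≤ M := by
  obtain ⟨Λ, hΛ0, hΛ⟩ := exists_bound_of_lambdaSup_lt_top hΛ
  have hη' : η =o[atTop] (fun R : ℝ => R ^ (2 * (1 : ℝ))) := by
    simpa using hη
  -- The rate gives `c' = 2Λc`, so `c' (1 + |x-z|²)` already dominates the spatial term `2Λc`.
  set c : ℝ → ℝ := fun s => Real.exp (2 * Λ * (s - T)) with hcdef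
  have hc : ContDiff ℝ 2 c := by fun_prop
  intro y s hs
  refine le_of_forall_pos_le_add_mul (e := Real.exp (barrier z T 1 1 c y s)) fun δ hδ => ?_
  refine le_of_barrier (z := z) (c := c) (η := η) (v := u) (p := 1) (δ := 1)
    (ε := Real.exp (2 * Λ * (0 - T)))
    (B := fun x t => M + δ * Real.exp (barrier z T 1 1 c x t))
    (Real.log ((1 + |M|) / δ)) one_pos (Real.exp_pos _) (fun t ht => ?_) one_pos
    (hu.mono (univ_prod_Ico_subset_closedStrip n T))
    (continuousOn_const.add (continuousOn_const.mul (continuousOn_barrier z T 1 1 hc).rexp))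
    (fun x => ?_) hη' ?_ ?_ y s hs
  · exact Real.exp_le_exp.mpr (mul_le_mul_of_nonneg_left (by linarith [ht.1]) (by linarith))
  · have : 0 < δ * Real.exp (barrier z T 1 1 c x 0) := by positivity
    linarith [h0 x]
  · filter_upwards [hgrow] with R hR q hq hle
    exact (hR q hq).trans (exp_barrier_growth hδ hle)
  · intro x t ht hmax
    have hΘ : ∀ τ, HasDerivAt (fun τ => M + δ * Real.exp τ) (δ * Real.exp τ) τ := fun τ =>
      ((Real.hasDerivAt_exp τ).const_mul δ).const_add M
    have h := hH.subsolution_touching hn hΛ hsub hc one_pos ht (Real.exp_pos _)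
      (hasDerivAt_exp_rate (2 * Λ) T t) 0 isOpen_univ
      (Θ := fun τ => M + δ * Real.exp τ) (Θ₁ := fun τ => δ * Real.exp τ)
      (by fun_prop) (fun τ _ => hΘ τ) (mem_univ _) (by positivity)
      ((Real.hasDerivAt_exp _).const_mul δ) (by simpa using hmax)
    have hTt : 0 < T - t := by linarith [ht.2]
    have h1 : 0 < 1 / (T - t) ^ 2 := by positivity
    have hct : 0 < c t := Real.exp_pos _
    simp only [Real.rpow_zero, Real.rpow_one, sub_self, one_mul, mul_one] at h
    change 2 * Λ * c t * _ + _ ≤ _ at h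
    nlinarith [mul_nonneg (mul_nonneg hΛ0 hct.le) (sq_nonneg ‖x - z‖)]

theorem minimum_principle_linear (hn : 2 ≤ n) (hH : IsStructuralOperator H 0)
    {u : Rn n → ℝ → ℝ}
    (hu : LowerSemicontinuousOn (fun p : Rn n × ℝ => u p.1 p.2) (closedStrip n T))
    (hsup : IsViscositySupersolution H (fun _ => 1) T u)
    {M : ℝ} (h0 : ∀ x, M ≤ u x 0) {z : Rn n} {η : ℝ → ℝ}
    (hη : η =o[atTop] (fun R : ℝ => R ^ 2))
    (hgrow : ∀ᶠ R in atTop, ∀ q ∈ cylinder z R T, -Real.exp (η R) ≤ u q.1 q.2) :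
    ∀ x, ∀ t ∈ Ioo 0 T, M ≤ u x t := by
  obtain ⟨C, hC0, hC⟩ := hH.exists_neg_id_bound
  have hη' : η =o[atTop] (fun R : ℝ => R ^ (2 * (1 : ℝ))) := by
    simpa using hη
  -- The concave profile `M - δ exp(-τ)` has `Θ'' = -Θ'`, so `κ = 1` and the spatial terms are `2Cc
  -- + 4Cc²|x-z|²`. Normalising at `T` gives `c ≤ 1`, and then the rate `4C` suffices.
  set c : ℝ → ℝ := fun s => Real.exp (4 * C * (s - T)) with hcdef
  have hc : ContDiff ℝ 2 c := by fun_prop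
  have hv : UpperSemicontinuousOn (fun p : Rn n × ℝ => -u p.1 p.2) (closedStrip n T) := by
    intro p hp y hy
    filter_upwards [hu p hp (-y) (by linarith)] with q hq
    linarith
  intro y s hs
  refine neg_le_neg_iff.mp ?_
  refine le_of_forall_pos_le_add_mul (e := Real.exp (barrier z T 1 1 c y s)) fun δ hδ => ?_
  refine le_of_barrier (z := z) (c := c) (η := η) (v := fun x t => -u x t) (p := 1) (δ := 1)
    (ε := Real.exp (4 * C * (0 - T)))
    (B := fun x t => -M + δ * Real.exp (barrier z T 1 1 c x t))
    (Real.log ((1 + |-M|) / δ)) one_pos (Real.exp_pos _) (fun t ht => ?_) one_pos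
    (hv.mono (univ_prod_Ico_subset_closedStrip n T))
    (continuousOn_const.add (continuousOn_const.mul (continuousOn_barrier z T 1 1 hc).rexp))
    (fun x => ?_) hη' ?_ ?_ y s hs
  · exact Real.exp_le_exp.mpr (mul_le_mul_of_nonneg_left (by linarith [ht.1]) (by linarith))
  · have : 0 < δ * Real.exp (barrier z T 1 1 c x 0) := by positivity
    linarith [h0 x]
  · filter_upwards [hgrow] with R hR q hq hle
    exact (neg_le.mp (hR q hq)).trans (exp_barrier_growth hδ hle)
  · intro x t ht hmax
    have hΘ : ∀ τ, HasDerivAt (fun τ => M - δ * Real.exp (-τ)) (δ * Real.exp (-τ)) τ := fun τ =>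
      (((hasDerivAt_neg τ).exp.const_mul δ).const_sub M).congr_deriv (by ring)
    have hΘ₁ : ∀ τ, HasDerivAt (fun τ => δ * Real.exp (-τ)) (-(1 * (δ * Real.exp (-τ)))) τ :=
      fun τ => ((hasDerivAt_neg τ).exp.const_mul δ).congr_deriv (by ring)
    have hmin : IsLocalMin (fun q : Rn n × ℝ => u q.1 q.2 -
        (M - δ * Real.exp (-(-1 * barrier z T 1 1 c q.1 q.2 + 0)))) (x, t) := by
      filter_upwards [hmax] with q hq
      simp only [neg_mul, one_mul, add_zero, neg_neg]
      linarith
    have h := hH.supersolution_touching hn hC hsup hc one_pos ht (Real.exp_pos _)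
      (hasDerivAt_exp_rate (4 * C) T t) 0 isOpen_univ
      (Θ := fun τ => M - δ * Real.exp (-τ)) (Θ₁ := fun τ => δ * Real.exp (-τ))
      (by fun_prop) (fun τ _ => hΘ τ) (mem_univ _) (by positivity) (hΘ₁ _) zero_le_one le_rfl hmin
    have hTt : 0 < T - t := by linarith [ht.2]
    have h1 : 0 < 1 / (T - t) ^ 2 := by positivity
    have hct : 0 < c t := Real.exp_pos _
    have hct1 : c t ≤ 1 := by
      rw [hcdef, Real.exp_le_one_iff]
      nlinarith
    simp only [Real.rpow_zero, Real.rpow_one, sub_self, abs_zero, mul_zero, zero_add, one_mul,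
      mul_one] at h
    change 4 * C * c t * _ + _ ≤ C * (1 + 2 * c t * _) * (2 * c t) at h
    have h2 : 0 ≤ C * c t * ‖x - z‖ ^ 2 := by positivity
    nlinarith [mul_nonneg hC0 hct.le, mul_le_mul_of_nonneg_right hct1 h2]

end LinearCase

/-! ### Growth hypotheses in terms of the primitive, and the conclusion. -/

theorem isChangeOfVariable_hasDerivAt {k : ℝ} {f φ : ℝ → ℝ} {I J : Set ℝ}
    (hφ : IsChangeOfVariable k f φ I) (hJ : IsOpen J) (hJI : J ⊆ I) {τ : ℝ} (hτ : τ ∈ J) :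
    HasDerivAt φ (f (φ τ) ^ (1 / (k - 1))) τ :=
  (hφ.hasDeriv τ (hJI hτ)).hasDerivAt (mem_of_superset (hJ.mem_nhds hτ) hJI)

/-- The primitive inverts a change of variable, up to an additive constant. -/
theorem exists_primitive_changeOfVariable {k : ℝ} {f φ : ℝ → ℝ} {I : Set ℝ}
    (hf : IsAdmissibleNonlinearity k f) (hI : I = Ici 0 ∨ I = univ)
    (hφ : IsChangeOfVariable k f φ I) :
    ∃ C : ℝ, ∀ τ ∈ interior I, 0 < φ τ ∧ primitive k f (φ τ) = τ + C := by
  have hpos : ∀ τ ∈ interior I, 0 < φ τ := by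
    intro τ hτ
    have : ∃ σ ∈ I, σ < τ := by
      rcases hI with rfl | rfl
      · rw [interior_Ici] at hτ
        exact ⟨0, self_mem_Ici, hτ⟩
      · exact ⟨τ - 1, trivial, by linarith⟩
    obtain ⟨σ, hσ, hστ⟩ := this
    exact (hφ.nonneg σ hσ).trans_lt (hφ.strictMonoOn hσ (interior_subset hτ) hστ)
  have hconv : Convex ℝ I := by
    rcases hI with rfl | rfl
    exacts [convex_Ici 0, convex_univ]
  obtain ⟨C, hC⟩ := hf.primitive_comp_eq isOpen_interior hconv.interior hpos
    fun τ hτ => isChangeOfVariable_hasDerivAt hφ isOpen_interior interior_subset hτ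
  exact ⟨C, fun τ hτ => ⟨hpos τ hτ, hC τ hτ⟩⟩

/-- A convergent integral bounds the primitive from below. -/
theorem exists_primitive_lower_bound {k : ℝ} {f : ℝ → ℝ} (hf : IsAdmissibleNonlinearity k f)
    {L : ℝ} (hL : Tendsto (primitiveIncrement k f) (𝓝[>] 0) (𝓝 L)) {s : ℝ} (hs : 0 < s) :
    -L ≤ primitive k f s := by
  have h1 : Tendsto (fun ε => -primitiveIncrement k f ε) (𝓝[>] 0) (𝓝 (-L)) := hL.neg
  refine le_of_tendsto h1 ?_
  filter_upwards [Ioo_mem_nhdsGT hs] with ε hε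
  have : -primitiveIncrement k f ε = primitive k f ε :=
    (intervalIntegral.integral_symm _ _).symm
  rw [this]
  exact hf.strictMonoOn_primitive.monotoneOn hε.1 hs hε.2.le

theorem theorem2p8 (n : ℕ) (hn : 2 ≤ n) (T : ℝ) (hT : 0 < T)
    (H : Rn n → Matrix (Fin n) (Fin n) ℝ → ℝ) (k k₁ : ℝ) (hk : k = k₁ + 1)
    (hH : IsStructuralOperator H k₁) (hΛ : LambdaSup H < ⊤)
    (g : Rn n → ℝ) (hg : Continuous g) (hg_pos : ∀ x, 0 < g x)
    (hg_inf : 0 < ⨅ x, g x) (hg_sup : BddAbove (range g)) (z : Rn n) :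
    -- maximum principle, `k > 1`
    (1 < k → ∀ (f φ : ℝ → ℝ) (I : Set ℝ), IsAdmissibleNonlinearity k f →
      (I = Ici 0 ∨ I = univ) → IsChangeOfVariable k f φ I →
      ∀ u : Rn n → ℝ → ℝ,
        UpperSemicontinuousOn (fun p : Rn n × ℝ => u p.1 p.2) (closedStrip n T) →
        (∀ p ∈ closedStrip n T, 0 < u p.1 p.2) →
        IsViscositySubsolution H f T u →
        (∀ x, u x 0 ≤ g x) →
        (∃ η : ℝ → ℝ, η =o[atTop] (fun R : ℝ => R ^ ((k + 1) / (k - 1))) ∧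
          ∀ᶠ R in atTop, η R ∈ I ∧ ∀ p ∈ cylinder z R T, u p.1 p.2 ≤ φ (η R)) →
        ∀ x, ∀ t ∈ Ioo 0 T, u x t ≤ ⨆ y, g y) ∧
    -- maximum principle, `k = 1`, `f ≡ 1`
    (k = 1 → ∀ u : Rn n → ℝ → ℝ,
        UpperSemicontinuousOn (fun p : Rn n × ℝ => u p.1 p.2) (closedStrip n T) →
        IsViscositySubsolution H (fun _ => 1) T u →
        (∀ x, u x 0 ≤ g x) →
        (∃ η : ℝ → ℝ, η =o[atTop] (fun R : ℝ => R ^ 2) ∧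
          ∀ᶠ R in atTop, ∀ p ∈ cylinder z R T, u p.1 p.2 ≤ Real.exp (η R)) →
        ∀ x, ∀ t ∈ Ioo 0 T, u x t ≤ ⨆ y, g y) ∧
    -- minimum principle, `k > 1`, convergent integral
    (1 < k → ∀ f : ℝ → ℝ, IsAdmissibleNonlinearity k f →
      (∃ L : ℝ, Tendsto (primitiveIncrement k f) (𝓝[>] 0) (𝓝 L)) →
      ∀ u : Rn n → ℝ → ℝ,
        LowerSemicontinuousOn (fun p : Rn n × ℝ => u p.1 p.2) (closedStrip n T) →
        (∀ p ∈ closedStrip n T, 0 < u p.1 p.2) →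
        IsViscositySupersolution H f T u →
        (∀ x, g x ≤ u x 0) →
        ∀ x, ∀ t ∈ Ioo 0 T, ⨅ y, g y ≤ u x t) ∧
    -- minimum principle, `k > 1`, divergent integral
    (1 < k → ∀ f φ : ℝ → ℝ, IsAdmissibleNonlinearity k f →
      Tendsto (primitiveIncrement k f) (𝓝[>] 0) atTop →
      IsChangeOfVariable k f φ univ →
      ∀ u : Rn n → ℝ → ℝ,
        LowerSemicontinuousOn (fun p : Rn n × ℝ => u p.1 p.2) (closedStrip n T) →
        (∀ p ∈ closedStrip n T, 0 < u p.1 p.2) →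
        IsViscositySupersolution H f T u →
        (∀ x, g x ≤ u x 0) →
        (∃ η : ℝ → ℝ, η =o[atTop] (fun R : ℝ => R ^ ((k + 1) / (k - 1))) ∧
          ∀ᶠ R in atTop, ∀ p ∈ cylinder z R T, φ (-η R) ≤ u p.1 p.2) →
        ∀ x, ∀ t ∈ Ioo 0 T, ⨅ y, g y ≤ u x t) ∧
    -- minimum principle, `k = 1`, `f ≡ 1`
    (k = 1 → ∀ u : Rn n → ℝ → ℝ,
        LowerSemicontinuousOn (fun p : Rn n × ℝ => u p.1 p.2) (closedStrip n T) →
        IsViscositySupersolution H (fun _ => 1) T u →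
        (∀ x, g x ≤ u x 0) →
        (∃ η : ℝ → ℝ, η =o[atTop] (fun R : ℝ => R ^ 2) ∧
          ∀ᶠ R in atTop, ∀ p ∈ cylinder z R T, -Real.exp (η R) ≤ u p.1 p.2) →
        ∀ x, ∀ t ∈ Ioo 0 T, ⨅ y, g y ≤ u x t) := by
  have hgb : BddBelow (range g) := ⟨0, by rintro _ ⟨x, rfl⟩; exact (hg_pos x).le⟩
  have hle : ∀ x, g x ≤ ⨆ y, g y := le_ciSup hg_sup
  have hge : ∀ x, ⨅ y, g y ≤ g x := ciInf_le hgb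
  have hM : 0 < ⨆ y, g y := (hg_pos 0).trans_le (hle 0)
  have hk₁0 : k = 1 → IsStructuralOperator H 0 := fun h => by
    have : k₁ = 0 := by linarith
    rwa [this] at hH
  refine ⟨?_, ?_, ?_, ?_, ?_⟩
  · rintro hk1 f φ I hf hI hφ u hu hpos hsub h0 ⟨η, hη, hgrow⟩
    obtain ⟨C, hC⟩ := exists_primitive_changeOfVariable hf hI hφ
    refine maximum_principle_of_one_lt hT hn hH hΛ hk1 hk hf hu hpos hsub hM
      (fun x => (h0 x).trans (hle x)) (z := z) (C := 1 + C) hη ?_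
    filter_upwards [hgrow] with R hR q hq
    -- If `I = [0,∞)`, then `η R` may be the end point, where `φ` can vanish; moving by `1` into the
    -- interior only changes the constant.
    have hint : η R + 1 ∈ interior I := by
      rcases hI with rfl | rfl
      · rw [interior_Ici]
        have : 0 ≤ η R := hR.1
        exact (by linarith : 0 < η R + 1)
      · simp
    have hlt : φ (η R) < φ (η R + 1) :=
      hφ.strictMonoOn hR.1 (interior_subset hint) (by linarith)
    obtain ⟨h1, h2⟩ := hC _ hint
    have h3 := hf.strictMonoOn_primitive.monotoneOn
      (hpos q ⟨trivial, hq.2.1.le, hq.2.2.le⟩) h1 ((hR.2 q hq).trans hlt.le)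
    linarith [le_abs_self (η R)]
  · rintro hk1 u hu hsub h0 ⟨η, hη, hgrow⟩
    exact maximum_principle_linear hn (hk₁0 hk1) hΛ hu hsub
      (fun x => (h0 x).trans (hle x)) (z := z) hη hgrow
  · rintro hk1 f hf ⟨L, hL⟩ u hu hpos hsup h0
    -- The primitive is bounded below by `-L`, so the growth condition holds with `η = 0`.
    refine minimum_principle_of_one_lt hT hn hH hk1 hk hf hu hpos hsup hg_inf
      (fun x => (hge x).trans (h0 x)) (z := z) (η := 0) (C := L) (isLittleO_zero _ _) ?_
    refine Eventually.of_forall fun R q hq => ?_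
    have := exists_primitive_lower_bound hf hL (hpos q ⟨trivial, hq.2.1.le, hq.2.2.le⟩)
    simp only [Pi.zero_apply, abs_zero]
    linarith
  · rintro hk1 f φ hf - hφ u hu hpos hsup h0 ⟨η, hη, hgrow⟩
    obtain ⟨C, hC⟩ := exists_primitive_changeOfVariable hf (Or.inr rfl) hφ
    refine minimum_principle_of_one_lt hT hn hH hk1 hk hf hu hpos hsup hg_inf
      (fun x => (hge x).trans (h0 x)) (z := z) (C := -C) hη ?_
    filter_upwards [hgrow] with R hR q hq
    obtain ⟨h1, h2⟩ := hC (-η R) (by simp)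
    have h3 := hf.strictMonoOn_primitive.monotoneOn h1
      (hpos q ⟨trivial, hq.2.1.le, hq.2.2.le⟩) (hR q hq)
    linarith [le_abs_self (η R)]
  · rintro hk1 u hu hsup h0 ⟨η, hη, hgrow⟩
    exact minimum_principle_linear hn (hk₁0 hk1) hu hsup
      (fun x => (hge x).trans (h0 x)) (z := z) hη hgrow
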